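/- **Data scaling law (optimal Bayesian cross-entropy loss of the syntax-knowledge model).** *Setting.* Fix a discount parameter $0\le\alpha<1$ and a concentration parameter $\beta>-\alpha$. Write $\mathbf\Phi_{\mathrm{knw}}=\{\phi\in\mathbb R^{d_{\mathrm{knw}}}:\|\phi\|_2\le1\}$ and $\mathbf\Phi_{\mathrm{syn}}=\{\phi\in\mathbb R^{d_{\mathrm{syn}}}:\|\phi\|_2\le1\}$. Let $\pi_{\mathrm{knw}},\pi_{\mathrm{syn}}$ be probability measures on $\mathbf\Phi_{\mathrm{knw}},\mathbf\Phi_{\mathrm{syn}}$. Let $(P_\phi)_{\phi\in\mathbf\Phi_{\mathrm{knw}}}$ and $(P_\phi)_{\phi\in\mathbf\Phi_{\mathrm{syn}}}$ be (measurable) families of probability distributions on a finite set $\mathbb K$ of knowledge elements and on a countable set $\Xi$ of syntactic elements, such that for constants $L_{\mathrm{knw}},L_{\mathrm{syn}}>0$ $$D_{\mathsf{KL}}(P_{\phi}\|P_{\phi'})\le L_{\mathrm{knw}}\|\phi-\phi'\|^2\ \ (\phi,\phi'\in\mathbf\Phi_{\mathrm{knw}}),\qquad D_{\mathsf{KL}}(P_{\phi}\|P_{\phi'})\le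 L_{\mathrm{syn}}\|\phi-\phi'\|^2\ \ (\phi,\phi'\in\mathbf\Phi_{\mathrm{syn}}).$$ Let $\sigma:\mathbb K\to\{1,\dots,n_s\}$ be a map, and let $(\xi,\kappa)\mapsto X$ be a one-to-one map from $\Xi\times\mathbb K$ to a countable set of sentences. *Prior.* In the Chinese restaurant process with parameters $\alpha,\beta$, the first customer opens a table, and the $n$-th customer joins an occupied table $k$ that has $N_k$ customers with probability $\frac{N_k-\alpha}{n-1+\beta}$ and opens a new table with probability $\frac{\beta+\alpha K}{n-1+\beta}$, where $K$ is the number of occupied tables; tables are numbered in the order of opening. Let $p_k=\lim_n N_k/n$ be the asymptotic table proportions, let $\phi_1,\phi_2,\dots$ be i.i.d. from $\pi_{\mathrm{knw}}$ and independent of $p$, and put $\phi_{\mathrm{knw}}=\sum_k p_k\delta_{\phi_k}$ (a sample of the Pitman–Yor process $\mathsf{PYP}(\alpha,\beta,\pi_{\mathrm{knw}})$). Independently, let $\phi_{\mathrm{syn}}=(\phi_{\mathrm{syn}}^{(1)},\dots,\phi_{\mathrm{syn}}^{(n_s)})$ be i.i.d. from $\pi_{\mathrm{syn}}$. Let $\pi$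 be the law of $\phi_{\mathrm{data}}=(\phi_{\mathrm{syn}},\phi_{\mathrm{knw}})$. *Data.* Given $\phi_{\mathrm{data}}$, a sentence $X\sim P_{\phi_{\mathrm{data}}}$ is generated by drawing $\kappa\sim\sum_k p_kP_{\phi_k}$, then $\xi\sim P_{\phi_{\mathrm{syn}}^{(\sigma(\kappa))}}$, and taking the sentence of $(\xi,\kappa)$. The corpus $X_{1:N}$ consists of $N\ge1$ sentences that are i.i.d. given $\phi_{\mathrm{data}}$. *Claim.* Let $\boldsymbol M$ range over all probability distributions $P_{\boldsymbol M}$ on sequences of $N$ sentences, and let $H(X_{1:N}|\mathbf\Phi_{\mathrm{data}})=\mathbb E_{\phi_{\mathrm{data}}\sim\pi}[H(X_{1:N}\mid\phi_{\mathrm{data}})]$ be the irreducible part of the loss. Then $$\inf_{\boldsymbol M}\frac1N\,\mathbb E_{\phi_{\mathrm{data}}\sim\pi}\,\mathbb E_{X_{1:N}\sim P_{\phi_{\mathrm{data}}}}\bigl[-\log P_{\boldsymbol M}(X_{1:N})\bigr]=\widetilde O\!\left(\frac{d_{\mathrm{knw}}}{N^{1-\alpha}}+\frac{n_sd_{\mathrm{syn}}}{N}\right)+\frac1N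 H(X_{1:N}|\mathbf\Phi_{\mathrm{data}}).$$ Here all quantities take values in $[0,\infty]$, and $\widetilde O$ hides logarithmic factors in the following sense. There are constants $C,r$ that depend only on $(\alpha,\beta)$ such that for all models as above and all $N\ge1$ the left-hand side equals $R+\frac1NH(X_{1:N}|\mathbf\Phi_{\mathrm{data}})$ for some $R\ge 0$ with $$R\le C\left(\ell_{\mathrm{knw}}^{\,r}\,\frac{d_{\mathrm{knw}}}{N^{1-\alpha}}+\ell_{\mathrm{syn}}^{\,r}\,\frac{n_sd_{\mathrm{syn}}}{N}\right),$$ where $\ell_{\mathrm{knw}}=1+\log N+\log|\mathbb K|+\log(1+d_{\mathrm{knw}})+\log(1+L_{\mathrm{knw}})$ and $\ell_{\mathrm{syn}}=1+\log N+\log(1+d_{\mathrm{syn}})+\log(1+L_{\mathrm{syn}})$. -/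

import Mathlib

open MeasureTheory ProbabilityTheory
open scoped ENNReal

noncomputable section

namespace SyntaxKnowledge

/-! ## Pitman-Yor Chinese restaurant process and Pitman-Yor process -/

/-- Admissible parameters of a Pitman-Yor process: the discount `α ∈ [0, 1)` and the
concentration `β > -α`. -/
structure PYParams where
  α : ℝ
  β : ℝ
  α_nonneg : 0 ≤ α
  α_lt_one : α < 1
  neg_α_lt_β : -α < β

/-- Number of customers sitting at table `k`, for a finite seating history
(`h i` is the table of customer `i`). -/
def tableCount {ι : Type*} [Fintype ι] (h : ι → ℕ) (k : ℕ) : ℕ :=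
  (Finset.univ.filter fun i => h i = k).card

/-- The set of occupied tables of a finite seating history. -/
def occupiedTables {ι : Type*} [Fintype ι] (h : ι → ℕ) : Finset ℕ :=
  Finset.univ.image h

/-- Law of the table of the next customer, given that the customers `0, …, n` (these are `n + 1`
customers) are seated according to `h`: an occupied table `k` is joined with probability
`(N_k - α) / (n + 1 + β)`, and a new table is opened with probability
`(β + α K) / (n + 1 + β)`, where `K` is the number of occupied tables. Tables are numbered
`0, 1, 2, …` in the order in which they are opened, so the new table gets the number `K`. -/
def crpNext (q : PYParams) (n : ℕ) (h : Finset.Iic n → ℕ) : Measure ℕ :=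
  (∑ k ∈ occupiedTables h,
      ENNReal.ofReal ((tableCount h k - q.α) / (n + 1 + q.β)) • Measure.dirac k)
    + ENNReal.ofReal ((q.β + q.α * (occupiedTables h).card) / (n + 1 + q.β)) •
        Measure.dirac (occupiedTables h).card

theorem isProbabilityMeasure_crpNext (q : PYParams) (n : ℕ) (h : Finset.Iic n → ℕ) :
    IsProbabilityMeasure (crpNext q n h) := by
  have h0 := q.α_nonneg
  have h1 := q.α_lt_one
  have h2 := q.neg_α_lt_β
  have hn : (0 : ℝ) ≤ n := n.cast_nonneg
  have hden : (0 : ℝ) < n + 1 + q.β := by linarith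
  have hcount : ∀ k ∈ occupiedTables h, (1 : ℝ) ≤ tableCount h k := by
    intro k hk
    obtain ⟨i, -, hi⟩ := Finset.mem_image.1 hk
    have : 0 < tableCount h k := Finset.card_pos.2 ⟨i, by simp [hi]⟩
    exact_mod_cast this
  have hcard : (1 : ℝ) ≤ (occupiedTables h).card := by
    have : 0 < (occupiedTables h).card :=
      Finset.card_pos.2 ⟨h ⟨0, by simp⟩, Finset.mem_image_of_mem _ (Finset.mem_univ _)⟩
    exact_mod_cast this
  have hsum : ∑ k ∈ occupiedTables h, (tableCount h k : ℝ) = n + 1 := by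
    have := Finset.card_eq_sum_card_image h (Finset.univ : Finset (Finset.Iic n))
    have h3 : (Finset.univ : Finset (Finset.Iic n)).card = n + 1 := by simp
    rw [h3] at this
    unfold tableCount occupiedTables
    exact_mod_cast this.symm
  refine ⟨?_⟩
  have hA : 0 ≤ (q.β + q.α * (occupiedTables h).card) / (n + 1 + q.β) := by
    refine div_nonneg ?_ hden.le
    nlinarith
  have hB : ∀ k ∈ occupiedTables h, 0 ≤ ((tableCount h k : ℝ) - q.α) / (n + 1 + q.β) :=
    fun k hk => div_nonneg (by linarith [hcount k hk]) hden.le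
  simp only [crpNext, Measure.add_apply, Measure.finsetSum_apply, Measure.smul_apply,
    measure_univ, smul_eq_mul, mul_one]
  rw [← ENNReal.ofReal_sum_of_nonneg hB, ← ENNReal.ofReal_add (Finset.sum_nonneg hB) hA,
    ← Finset.sum_div, Finset.sum_sub_distrib, hsum, ← add_div]
  simp only [Finset.sum_const, nsmul_eq_mul]
  rw [show (n : ℝ) + 1 - (occupiedTables h).card * q.α
    + (q.β + q.α * (occupiedTables h).card) = n + 1 + q.β by ring, div_self hden.ne']
  simp

/-- `crpNext` as a transition kernel from seating histories to tables. -/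
def crpKernel (q : PYParams) (n : ℕ) : Kernel (Finset.Iic n → ℕ) ℕ :=
  ⟨crpNext q n, Measurable.of_discrete⟩

instance isMarkovKernel_crpKernel (q : PYParams) (n : ℕ) : IsMarkovKernel (crpKernel q n) :=
  ⟨isProbabilityMeasure_crpNext q n⟩

/-- The law of the Pitman-Yor Chinese restaurant process: a random sequence `s`, where `s i` is
the table of customer `i`. Customer `0` opens table `0`; every later customer follows
`crpNext`. -/
def crpLaw (q : PYParams) : Measure (ℕ → ℕ) :=
  Kernel.trajMeasure (X := fun _ => ℕ) (Measure.dirac 0) (crpKernel q)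

instance isProbabilityMeasure_crpLaw (q : PYParams) : IsProbabilityMeasure (crpLaw q) := by
  unfold crpLaw; infer_instance

/-- The asymptotic relative size `p_k = lim_n N_k(n) / n` of table `k`. (The limit exists almost
surely under `crpLaw`; `limsup` makes the definition total and measurable.) -/
def crpWeight (s : ℕ → ℕ) (k : ℕ) : ℝ≥0∞ :=
  Filter.limsup (fun n : ℕ => (tableCount (fun i : Fin n => s i) k : ℝ≥0∞) / n) Filter.atTop

theorem measurable_crpWeight (k : ℕ) : Measurable fun s : ℕ → ℕ => crpWeight s k := by
  unfold crpWeight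
  refine Measurable.limsup fun n => ?_
  have h : Measurable fun s : ℕ → ℕ => fun i : Fin n => s i := by fun_prop
  have h2 : Measurable fun t : Fin n → ℕ => (tableCount t k : ℝ≥0∞) / n := Measurable.of_discrete
  exact h2.comp h

/-- The random measure `∑ k, p_k δ_{φ_k}` with the weights of the seating sequence and the given
atoms. -/
def pyMixture {Φ : Type*} [MeasurableSpace Φ] (ω : (ℕ → ℕ) × (ℕ → Φ)) : Measure Φ :=
  Measure.sum fun k => crpWeight ω.1 k • Measure.dirac (ω.2 k)

theorem measurable_pyMixture {Φ : Type*} [MeasurableSpace Φ] :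
    Measurable (pyMixture (Φ := Φ)) := by
  refine Measure.measurable_of_measurable_coe _ fun s hs => ?_
  simp only [pyMixture, Measure.sum_apply _ hs, Measure.smul_apply, smul_eq_mul,
    Measure.dirac_apply' _ hs]
  refine Measurable.tsum fun k => ?_
  refine ((measurable_crpWeight k).comp measurable_fst).mul ?_
  exact (measurable_one.indicator hs).comp ((measurable_pi_apply k).comp measurable_snd)

/-- The Pitman-Yor process `PYP(α, β, ρ)`: the law of the random measure `∑ k, p_k δ_{φ_k}`, where
`p` are the table proportions of the Chinese restaurant process and the atoms `φ_k` are i.i.d. with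
law `ρ`, independent of `p`. -/
def pitmanYor (q : PYParams) {Φ : Type*} [MeasurableSpace Φ] (ρ : Measure Φ)
    [IsProbabilityMeasure ρ] : Measure (Measure Φ) :=
  ((crpLaw q).prod (Measure.infinitePi fun _ : ℕ => ρ)).map pyMixture

instance isProbabilityMeasure_pitmanYor (q : PYParams) {Φ : Type*} [MeasurableSpace Φ]
    (ρ : Measure Φ) [IsProbabilityMeasure ρ] : IsProbabilityMeasure (pitmanYor q ρ) :=
  Measure.isProbabilityMeasure_map measurable_pyMixture.aemeasurable

/-! ## The hierarchical syntax-knowledge data model -/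

/-- The parameter space `{φ ∈ ℝ^d : ‖φ‖₂ ≤ 1}`. -/
abbrev ParamBall (d : ℕ) : Type :=
  Metric.closedBall (0 : EuclideanSpace ℝ (Fin d)) 1

/-- The ingredients of a syntax-knowledge model with `dk`-dimensional knowledge parameters and `ns`
syntax parameter vectors of dimension `ds`. `K` is the set of knowledge elements, `Ξ` the set of
syntactic elements and `S` the set of sentences. -/
structure Model (dk ds ns : ℕ) (K Ξ S : Type*)
    [MeasurableSpace K] [MeasurableSpace Ξ] [MeasurableSpace S] where
  /-- the base measure of the knowledge cluster parameters -/
  knwBase : Measure (ParamBall dk)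
  /-- the prior of each syntax parameter vector -/
  synBase : Measure (ParamBall ds)
  [isProb_knwBase : IsProbabilityMeasure knwBase]
  [isProb_synBase : IsProbabilityMeasure synBase]
  /-- the family of distributions of a knowledge element within a cluster -/
  knw : Kernel (ParamBall dk) K
  /-- the family of distributions of a syntactic element -/
  syn : Kernel (ParamBall ds) Ξ
  [isMarkov_knw : IsMarkovKernel knw]
  [isMarkov_syn : IsMarkovKernel syn]
  /-- the index of the syntax parameter vector that is used for a knowledge element -/
  select : K → Fin ns
  /-- the sentence that expresses a pair of a syntactic element and a knowledge element -/
  encode : Ξ × K → S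
  encode_injective : Function.Injective encode

attribute [instance] Model.isProb_knwBase Model.isProb_synBase
  Model.isMarkov_knw Model.isMarkov_syn

/-- The latent data parameter `φ_data = (φ_syn, φ_knw)`. -/
abbrev DataParam (dk ds ns : ℕ) : Type :=
  (Fin ns → ParamBall ds) × Measure (ParamBall dk)

namespace Model

variable {dk ds ns : ℕ} {K Ξ S : Type*}
  [MeasurableSpace K] [MeasurableSpace Ξ] [MeasurableSpace S]

/-- The prior of `φ_data`: the syntax parameter vectors are i.i.d. and independent of the
knowledge model, which is a Pitman-Yor process. -/
def prior (m : Model dk ds ns K Ξ S) (q : PYParams) : Measure (DataParam dk ds ns) :=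
  (Measure.pi fun _ : Fin ns => m.synBase).prod (pitmanYor q m.knwBase)

/-- The law of one sentence given `φ_data`: a knowledge element `κ` is drawn from the mixture
`∫ P_φ dφ_knw(φ)`, a syntactic element `ξ` from the syntax vector selected by `κ`, and the
sentence is `encode (ξ, κ)`. -/
def sentenceLaw (m : Model dk ds ns K Ξ S) (φ : DataParam dk ds ns) : Measure S :=
  (φ.2.bind m.knw).bind fun κ => (m.syn (φ.1 (m.select κ))).map fun ξ => m.encode (ξ, κ)

/-- The law `P_{φ_data}^N` of a corpus of `N` conditionally i.i.d. sentences. -/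
def corpusLaw (m : Model dk ds ns K Ξ S) (N : ℕ) (φ : DataParam dk ds ns) :
    Measure (Fin N → S) :=
  Measure.pi fun _ : Fin N => m.sentenceLaw φ

/-- Both parametric families have Kullback-Leibler divergence at most a constant times the squared
distance of the parameters. -/
def KLLipschitz (m : Model dk ds ns K Ξ S) (Lk Ls : ℝ) : Prop :=
  (∀ φ₁ φ₂ : ParamBall dk, InformationTheory.klDiv (m.knw φ₁) (m.knw φ₂) ≤
      ENNReal.ofReal (Lk * ‖(φ₁ : EuclideanSpace ℝ (Fin dk)) - φ₂‖ ^ 2)) ∧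
  (∀ φ₁ φ₂ : ParamBall ds, InformationTheory.klDiv (m.syn φ₁) (m.syn φ₂) ≤
      ENNReal.ofReal (Ls * ‖(φ₁ : EuclideanSpace ℝ (Fin ds)) - φ₂‖ ^ 2))

end Model

/-! ## Losses -/

/-- The log-loss `-log p ∈ [0, ∞]` of a probability `p`, with `-log 0 = ∞`. -/
def negLog (p : ℝ≥0∞) : ℝ≥0∞ := (-ENNReal.log p).toENNReal

/-- The Shannon entropy of a discrete law, in nats. -/
def entropy {A : Type*} [MeasurableSpace A] (μ : Measure A) : ℝ≥0∞ :=
  ∫⁻ x, negLog (μ {x}) ∂μ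

namespace Model

variable {dk ds ns : ℕ} {K Ξ S : Type*}
  [MeasurableSpace K] [MeasurableSpace Ξ] [MeasurableSpace S]

/-- The Bayesian cross-entropy loss
`E_{φ_data ∼ π} E_{X_{1:N} ∼ P_{φ_data}} [-log Q(X_{1:N})]` of a predictive model `Q`. -/
def bayesLoss (m : Model dk ds ns K Ξ S) (q : PYParams) (N : ℕ) (Q : PMF (Fin N → S)) : ℝ≥0∞ :=
  ∫⁻ φ, ∫⁻ x, negLog (Q x) ∂(m.corpusLaw N φ) ∂(m.prior q)

/-- The conditional entropy `H(X_{1:N} | Φ_data) = E_{φ_data ∼ π} [H(X_{1:N} | φ_data)]`. -/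
def condEntropy (m : Model dk ds ns K Ξ S) (q : PYParams) (N : ℕ) : ℝ≥0∞ :=
  ∫⁻ φ, entropy (m.corpusLaw N φ) ∂(m.prior q)

end Model

end SyntaxKnowledge

end

/-!
The excess `R` of the optimal loss over the conditional entropy is nonnegative by Gibbs' inequality
(`Model.condEntropy_le_bayesLoss`). For the upper bound it suffices to exhibit one model `Q`, and `Q`
is taken as a finite mixture of product laws, so that coding with `Q` costs at most the code length
of one component plus `N` times the divergence from the true sentence law to that component
(`Model.exists_pmf_of_hasCode`). By the chain rule for cross-entropies, the divergence of sentences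
splits into a knowledge part and a syntax part.

*Syntax.* A grid of mesh of order `1 / (N L)` has `exp O(d log (N L))` cells, and the laws of two
points of one cell have divergence at most `d / N`. The `ns` syntax vectors therefore cost
`O(ns d log (N L))` in all (`exists_code_syntax`, `syntaxCost_le`).

*Knowledge.* The mixture `∑ p_k P_{φ_k}` is truncated to the (random) set of tables that the first
`N` customers occupy. Each of these tables is described by a grid cell for its atom and by the
integer `⌊N p_k⌋`; a uniform component accounts for the remaining mass. By the log-sum inequality
(`sum_mul_log_mixture_le`) the cost is, up to logarithms, `d` times the number `K_N` of these tables
plus `N` times the mass of the other tables (`hasCode_knowledge`).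

*The restaurant.* Both quantities have expectation `O(N ^ α log N)` (`exists_crp_bounds`). For
`E K_N` this follows from the recursion
`E K_{n+1} ≤ E K_n (1 + α / (n + β)) + |β| / (n + β)`. For the unseen mass, the customers at tables
opened after the first `N` customers behave like one colour of a Pólya urn started at weight
`β + α K_N` out of `N + β`, so that their expected limiting proportion is at most
`E (β + α K_N) / (N + β)`; the passage to the limit uses martingale convergence of the table
proportions (`ae_tendsto_crpWeight`) and Fatou's lemma. Since this bound tends to zero, the
proportions sum to one almost surely (`ae_tsum_crpWeight`).
-/

open MeasureTheory ProbabilityTheory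
open scoped ENNReal

noncomputable section

namespace SyntaxKnowledge

open Filter Topology

/-! ### Log-loss, entropy and divergence on countable spaces -/

theorem negLog_eq_ofReal {p : ℝ≥0∞} (h0 : p ≠ 0) (h1 : p ≠ ∞) :
    negLog p = ENNReal.ofReal (-Real.log p.toReal) := by
  rw [negLog, ENNReal.log_pos_real h0 h1, ← EReal.coe_neg, EReal.real_coe_toENNReal]

theorem negLog_zero : negLog 0 = ∞ := by simp [negLog]

theorem negLog_one : negLog 1 = 0 := by simp [negLog]

theorem negLog_anti {p q : ℝ≥0∞} (h : p ≤ q) : negLog q ≤ negLog p :=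
  EReal.toENNReal_le_toENNReal (EReal.neg_le_neg_iff.2 (ENNReal.log_le_log h))

theorem negLog_mul {p q : ℝ≥0∞} (hp : p ≤ 1) (hq : q ≤ 1) :
    negLog (p * q) = negLog p + negLog q := by
  have h1 : ENNReal.log p ≤ 0 := ENNReal.log_le_zero_iff.2 hp
  have h2 : ENNReal.log q ≤ 0 := ENNReal.log_le_zero_iff.2 hq
  have h3 : ENNReal.log p ≠ ⊤ := fun h => by simp [h] at h1
  have h4 : ENNReal.log q ≠ ⊤ := fun h => by simp [h] at h2
  rw [negLog, negLog, negLog, ENNReal.log_mul_add, EReal.neg_add (Or.inr h4) (Or.inl h3),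
    sub_eq_add_neg, EReal.toENNReal_add (EReal.neg_nonneg.2 h1) (EReal.neg_nonneg.2 h2)]

theorem negLog_prod {ι : Type*} (s : Finset ι) {p : ι → ℝ≥0∞} (hp : ∀ i ∈ s, p i ≤ 1) :
    negLog (∏ i ∈ s, p i) = ∑ i ∈ s, negLog (p i) := by
  classical
  induction s using Finset.induction_on with
  | empty => simp [negLog_one]
  | insert a s ha ih =>
    have h := fun i hi => hp i (Finset.mem_insert_of_mem hi)
    rw [Finset.prod_insert ha, Finset.sum_insert ha, negLog_mul (hp a (Finset.mem_insert_self a s))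
      (Finset.prod_le_one' h), ih h]

/-- The cross-entropy splits into the entropy and the Kullback-Leibler divergence. -/
theorem lintegral_negLog_eq_entropy_add_klDiv {A : Type*} [Countable A] [MeasurableSpace A]
    [DiscreteMeasurableSpace A] (P Q : Measure A) [IsProbabilityMeasure P]
    [IsProbabilityMeasure Q] :
    ∫⁻ x, negLog (Q {x}) ∂P = entropy P + InformationTheory.klDiv P Q := by
  by_cases hac : P ≪ Q
  · have hd : ∀ x, P.rnDeriv Q x * Q {x} = P {x} := by
      intro x
      conv_rhs => rw [← Measure.withDensity_rnDeriv_eq P Q hac]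
      rw [withDensity_apply _ (measurableSet_singleton x), lintegral_singleton]
    -- adding `P {x}` and `Q {x}` keeps all terms nonnegative; both sum to one and cancel at the end
    have hpt : ∀ x, negLog (Q {x}) * P {x} + Q {x} =
        negLog (P {x}) * P {x}
          + ENNReal.ofReal (InformationTheory.klFun (P.rnDeriv Q x).toReal) * Q {x} + P {x} := by
      intro x
      by_cases hq : Q {x} = 0
      · have hp : P {x} = 0 := hac hq
        simp [hp, hq]
      have hqt : Q {x} ≠ ∞ := measure_ne_top _ _
      by_cases hp : P {x} = 0
      · have : P.rnDeriv Q x = 0 := by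
          have := hd x; rw [hp] at this; exact (mul_eq_zero.1 this).resolve_right hq
        simp [hp, this, InformationTheory.klFun_zero]
      have hpt : P {x} ≠ ∞ := measure_ne_top _ _
      have hdx : (P.rnDeriv Q x).toReal = (P {x}).toReal / (Q {x}).toReal := by
        rw [← hd x, ENNReal.toReal_mul, mul_div_cancel_right₀]
        exact (ENNReal.toReal_pos hq hqt).ne'
      have hp0 := ENNReal.toReal_pos hp hpt
      have hq0 := ENNReal.toReal_pos hq hqt
      have hp1 : (P {x}).toReal ≤ 1 := measureReal_le_one
      have hq1 : (Q {x}).toReal ≤ 1 := measureReal_le_one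
      rw [negLog_eq_ofReal hp hpt, negLog_eq_ofReal hq hqt, hdx]
      generalize hP : (P {x}).toReal = a at *
      generalize hQ : (Q {x}).toReal = b at *
      rw [← ENNReal.ofReal_toReal hpt, ← ENNReal.ofReal_toReal hqt, hP, hQ]
      have hla := Real.log_nonpos hp0.le hp1
      have hlb := Real.log_nonpos hq0.le hq1
      have hk := InformationTheory.klFun_nonneg (div_nonneg hp0.le hq0.le)
      rw [← ENNReal.ofReal_mul (by linarith), ← ENNReal.ofReal_mul (by linarith),
        ← ENNReal.ofReal_mul hk, ← ENNReal.ofReal_add (by nlinarith) hq0.le,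
        ← ENNReal.ofReal_add (by nlinarith) (by positivity),
        ← ENNReal.ofReal_add (add_nonneg (by nlinarith) (by positivity)) hp0.le]
      congr 1
      rw [InformationTheory.klFun_apply, Real.log_div hp0.ne' hq0.ne']
      field_simp
      ring
    have hP1 : ∑' x, P {x} = 1 := by
      have := lintegral_countable' (μ := P) (fun _ => (1 : ℝ≥0∞)); simpa using this.symm
    have hQ1 : ∑' x, Q {x} = 1 := by
      have := lintegral_countable' (μ := Q) (fun _ => (1 : ℝ≥0∞)); simpa using this.symm
    have hsum := tsum_congr (L := .unconditional A) hpt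
    rw [ENNReal.tsum_add, ENNReal.tsum_add, ENNReal.tsum_add, hP1, hQ1] at hsum
    rw [InformationTheory.klDiv_eq_lintegral_klFun_of_ac hac, entropy, lintegral_countable',
      lintegral_countable', lintegral_countable']
    exact (ENNReal.add_left_inj ENNReal.one_ne_top).1 hsum
  · rw [InformationTheory.klDiv_of_not_ac hac, add_top]
    have : ∃ x, Q {x} = 0 ∧ P {x} ≠ 0 := by
      by_contra! h
      refine hac fun s hs => ?_
      rw [← Set.biUnion_of_singleton s]
      refine (measure_biUnion_null_iff (Set.to_countable s)).2 fun x hx => h x ?_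
      exact measure_mono_null (Set.singleton_subset_iff.2 hx) hs
    obtain ⟨x, hx, hx'⟩ := this
    rw [lintegral_countable']
    refine ENNReal.tsum_eq_top_of_eq_top ⟨x, ?_⟩
    rw [hx, negLog_zero, ENNReal.top_mul hx']

/-- Gibbs' inequality. -/
theorem entropy_le_lintegral_negLog {A : Type*} [Countable A] [MeasurableSpace A]
    [DiscreteMeasurableSpace A] (P Q : Measure A) [IsProbabilityMeasure P]
    [IsProbabilityMeasure Q] :
    entropy P ≤ ∫⁻ x, negLog (Q {x}) ∂P := by
  rw [lintegral_negLog_eq_entropy_add_klDiv]; exact le_self_add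

/-- The log-loss of a product law is additive over the coordinates. -/
theorem lintegral_negLog_pi {ι A : Type*} [Fintype ι] [Countable A] [MeasurableSpace A]
    [DiscreteMeasurableSpace A] (P Q : Measure A) [IsProbabilityMeasure P]
    [IsProbabilityMeasure Q] :
    ∫⁻ x, negLog ((Measure.pi fun _ : ι => Q) {x}) ∂(Measure.pi fun _ : ι => P) =
      Fintype.card ι * ∫⁻ x, negLog (Q {x}) ∂P := by
  simp_rw [Measure.pi_singleton, negLog_prod Finset.univ fun _ _ => prob_le_one]
  have hm : Measurable fun a : A => negLog (Q {a}) := Measurable.of_discrete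
  rw [lintegral_finsetSum (f := fun (i : ι) (x : ι → A) => negLog (Q {x i})) _
    fun i _ => hm.comp (measurable_pi_apply i)]
  have : ∀ i : ι, ∫⁻ x : ι → A, negLog (Q {x i}) ∂(Measure.pi fun _ : ι => P) =
      ∫⁻ x, negLog (Q {x}) ∂P := fun i =>
    (measurePreserving_eval (fun _ : ι => P) i).lintegral_comp hm
  simp [this]

/-- The log-sum inequality. -/
theorem sum_mul_log_div_le {ι : Type*} (s : Finset ι) {a b : ι → ℝ} (ha : ∀ i ∈ s, 0 ≤ a i)
    (hb : ∀ i ∈ s, 0 ≤ b i) (hab : ∀ i ∈ s, b i = 0 → a i = 0) :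
    (∑ i ∈ s, a i) * Real.log ((∑ i ∈ s, a i) / ∑ i ∈ s, b i) ≤
      ∑ i ∈ s, a i * Real.log (a i / b i) := by
  rcases (Finset.sum_nonneg ha).eq_or_lt with hA | hA
  · have h0 := (Finset.sum_eq_zero_iff_of_nonneg ha).1 hA.symm
    rw [← hA, Finset.sum_eq_zero (f := fun i => a i * Real.log (a i / b i))
      fun i hi => by rw [h0 i hi, zero_mul]]
    simp
  have hB : 0 < ∑ i ∈ s, b i := by
    refine (Finset.sum_nonneg hb).lt_of_ne fun h => ?_
    have h0 := (Finset.sum_eq_zero_iff_of_nonneg hb).1 h.symm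
    rw [Finset.sum_eq_zero fun i hi => hab i hi (h0 i hi)] at hA
    exact hA.false
  set A := ∑ i ∈ s, a i
  set B := ∑ i ∈ s, b i
  -- tangent line bound for each summand: `log y ≥ 1 - 1 / y` at `y = (a i / b i) / (A / B)`
  have key : ∀ i ∈ s, a i * Real.log (A / B) + a i - b i * (A / B) ≤
      a i * Real.log (a i / b i) := by
    intro i hi
    rcases (ha i hi).eq_or_lt with h0 | h0
    · rw [← h0]
      have := mul_nonneg (hb i hi) (div_nonneg hA.le hB.le)
      simp; linarith
    have hbi : 0 < b i := (hb i hi).lt_of_ne fun h => h0.ne' (hab i hi h.symm)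
    have h1 := Real.one_sub_inv_le_log_of_pos (x := a i / b i / (A / B)) (by positivity)
    rw [Real.log_div (by positivity) (by positivity)] at h1
    have h2 := mul_le_mul_of_nonneg_left h1 h0.le
    have h3 : a i * (1 - (a i / b i / (A / B))⁻¹) = a i - b i * (A / B) := by
      field_simp
    rw [h3] at h2
    linarith
  calc A * Real.log (A / B) = ∑ i ∈ s, (a i * Real.log (A / B) + a i - b i * (A / B)) := by
        rw [Finset.sum_sub_distrib, Finset.sum_add_distrib, ← Finset.sum_mul, ← Finset.sum_mul]
        have : B * (A / B) = A := by field_simp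
        change _ = A * _ + A - B * (A / B)
        rw [this]; ring
    _ ≤ _ := Finset.sum_le_sum key

/-- Coding with a law that dominates `w` times another law costs at most `-log w` extra. -/
theorem lintegral_negLog_le_of_mul_le {A : Type*} [MeasurableSpace A] (P : Measure A)
    [IsProbabilityMeasure P] {Q Q' : A → ℝ≥0∞} {w : ℝ≥0∞} (hw : w ≤ 1) (hQ' : ∀ x, Q' x ≤ 1)
    (h : ∀ x, w * Q' x ≤ Q x) :
    ∫⁻ x, negLog (Q x) ∂P ≤ negLog w + ∫⁻ x, negLog (Q' x) ∂P := by
  calc ∫⁻ x, negLog (Q x) ∂P ≤ ∫⁻ x, (negLog w + negLog (Q' x)) ∂P :=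
        lintegral_mono fun x => (negLog_anti (h x)).trans_eq (negLog_mul hw (hQ' x))
    _ = _ := by rw [lintegral_add_left measurable_const]; simp

/-! ### Seating sequences and the one-step law of the restaurant -/

/-- The tables occupied by the first `n` customers of a seating sequence. -/
def occ (s : ℕ → ℕ) (n : ℕ) : Finset ℕ := (Finset.range n).image s

/-- The number of customers at table `k` among the first `n` customers. -/
def cnt (s : ℕ → ℕ) (n k : ℕ) : ℕ := ((Finset.range n).filter fun i => s i = k).card

theorem tableCount_fin (s : ℕ → ℕ) (n k : ℕ) :
    tableCount (fun i : Fin n => s i) k = cnt s n k := by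
  unfold tableCount cnt
  refine Finset.card_bij (fun i _ => (i : ℕ)) ?_ ?_ ?_
  · intro i hi; simpa using hi
  · intro i _ j _ h; exact Fin.ext h
  · intro j hj
    simp only [Finset.mem_filter, Finset.mem_range] at hj
    exact ⟨⟨j, hj.1⟩, by simpa using hj.2, rfl⟩

theorem tableCount_frestrictLe (s : ℕ → ℕ) (n k : ℕ) :
    tableCount (Preorder.frestrictLe (π := fun _ => ℕ) n s) k = cnt s (n + 1) k := by
  unfold tableCount cnt
  refine Finset.card_bij (fun i _ => (i : ℕ)) ?_ ?_ ?_
  · intro i hi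
    have := Finset.mem_Iic.1 i.2
    simp only [Finset.mem_filter, Finset.mem_range]
    exact ⟨by omega, (Finset.mem_filter.1 hi).2⟩
  · intro i _ j _ h; exact Subtype.ext h
  · intro j hj
    simp only [Finset.mem_filter, Finset.mem_range] at hj
    exact ⟨⟨j, Finset.mem_Iic.2 (by omega)⟩, Finset.mem_filter.2 ⟨Finset.mem_univ _, hj.2⟩, rfl⟩

theorem occupiedTables_frestrictLe (s : ℕ → ℕ) (n : ℕ) :
    occupiedTables (Preorder.frestrictLe (π := fun _ => ℕ) n s) = occ s (n + 1) := by
  ext k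
  simp only [occupiedTables, occ, Finset.mem_image, Finset.mem_range, Finset.mem_univ, true_and]
  constructor
  · rintro ⟨i, hi⟩
    have := Finset.mem_Iic.1 i.2
    exact ⟨i, by omega, hi⟩
  · rintro ⟨j, hj, h⟩
    exact ⟨⟨j, Finset.mem_Iic.2 (by omega)⟩, h⟩

theorem occ_mono (s : ℕ → ℕ) {m n : ℕ} (h : m ≤ n) : occ s m ⊆ occ s n :=
  Finset.image_subset_image (Finset.range_subset_range.2 h)

theorem occ_succ (s : ℕ → ℕ) (n : ℕ) : occ s (n + 1) = insert (s n) (occ s n) := by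
  rw [occ, Finset.range_add_one, Finset.image_insert, occ]

theorem card_occ_le (s : ℕ → ℕ) (n : ℕ) : (occ s n).card ≤ n :=
  Finset.card_image_le.trans_eq (Finset.card_range n)

theorem card_occ_pos (s : ℕ → ℕ) {n : ℕ} (h : 0 < n) : 0 < (occ s n).card :=
  Finset.card_pos.2 ⟨s 0, Finset.mem_image_of_mem _ (Finset.mem_range.2 h)⟩

theorem cnt_pos {s : ℕ → ℕ} {n k : ℕ} (h : k ∈ occ s n) : 0 < cnt s n k := by
  obtain ⟨i, hi, rfl⟩ := Finset.mem_image.1 h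
  exact Finset.card_pos.2 ⟨i, Finset.mem_filter.2 ⟨hi, rfl⟩⟩

theorem cnt_eq_zero {s : ℕ → ℕ} {n k : ℕ} (h : k ∉ occ s n) : cnt s n k = 0 := by
  rw [cnt, Finset.card_eq_zero, Finset.filter_eq_empty_iff]
  exact fun i hi hk => h (Finset.mem_image.2 ⟨i, hi, hk⟩)

theorem cnt_le (s : ℕ → ℕ) (n k : ℕ) : cnt s n k ≤ n :=
  (Finset.card_filter_le _ _).trans_eq (Finset.card_range n)

theorem cnt_succ (s : ℕ → ℕ) (n k : ℕ) :
    cnt s (n + 1) k = cnt s n k + if s n = k then 1 else 0 := by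
  unfold cnt
  rw [Finset.range_add_one, Finset.filter_insert]
  split_ifs with h <;> simp

/-- The number of customers among the first `n` that sit outside the tables in `J`. -/
def cntOutside (s : ℕ → ℕ) (n : ℕ) (J : Finset ℕ) : ℕ :=
  ((Finset.range n).filter fun i => s i ∉ J).card

theorem sum_cnt_add_cntOutside (s : ℕ → ℕ) (n : ℕ) (J : Finset ℕ) :
    ∑ k ∈ J, cnt s n k + cntOutside s n J = n := by
  have h1 : ∑ k ∈ J, cnt s n k = ((Finset.range n).filter fun i => s i ∈ J).card := by
    rw [Finset.card_eq_sum_card_fiberwise (f := s) (t := J)]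
    · refine Finset.sum_congr rfl fun k hk => ?_
      rw [cnt, Finset.filter_filter]
      congr 1
      refine Finset.filter_congr fun i _ => ⟨fun h => ⟨h ▸ hk, h⟩, fun h => h.2⟩
    · intro i hi
      simpa using (Finset.mem_filter.1 hi).2
  rw [h1, cntOutside, Finset.card_filter_add_card_filter_not, Finset.card_range]

theorem cntOutside_succ (s : ℕ → ℕ) (n : ℕ) (J : Finset ℕ) :
    cntOutside s (n + 1) J = cntOutside s n J + if s n ∈ J then 0 else 1 := by
  unfold cntOutside
  rw [Finset.range_add_one, Finset.filter_insert]
  by_cases h : s n ∈ J <;> simp [h]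

/-- A function of a sequence that only looks at the first `n` entries. -/
def DependsOnPrefix {β : Type*} (n : ℕ) (F : (ℕ → ℕ) → β) : Prop :=
  ∀ s t : ℕ → ℕ, (∀ i < n, s i = t i) → F s = F t

theorem dependsOnPrefix_occ (n : ℕ) : DependsOnPrefix n fun s => occ s n := fun _ _ h =>
  Finset.image_congr fun i hi => h i (Finset.mem_range.1 hi)

theorem dependsOnPrefix_cnt (n k : ℕ) : DependsOnPrefix n fun s => cnt s n k := fun s t h => by
  unfold cnt
  exact congrArg _ (Finset.filter_congr fun i hi => by rw [h i (Finset.mem_range.1 hi)])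

theorem dependsOnPrefix_cntOutside {m n : ℕ} (hmn : m ≤ n) :
    DependsOnPrefix n fun s => cntOutside s n (occ s m) := fun s t h => by
  have : occ s m = occ t m := dependsOnPrefix_occ m s t fun i hi => h i (hi.trans_le hmn)
  simp only [cntOutside, this]
  exact congrArg _ (Finset.filter_congr fun i hi => by rw [h i (Finset.mem_range.1 hi)])

theorem DependsOnPrefix.measurable_piLE {β : Type*} [MeasurableSpace β] {n : ℕ}
    {F : (ℕ → ℕ) → β} (h : DependsOnPrefix (n + 1) F) :
    Measurable[Filtration.piLE (X := fun _ : ℕ => ℕ) n] F := by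
  have h1 : F = (fun t : Finset.Iic n → ℕ => F fun i =>
      if hi : i ∈ Finset.Iic n then t ⟨i, hi⟩ else 0) ∘
      Preorder.frestrictLe (π := fun _ => ℕ) n := by
    funext s
    exact h _ _ fun i hi => by simp [Nat.le_of_lt_succ hi]
  rw [h1, Filtration.piLE_eq_comap_frestrictLe]
  exact Measurable.of_discrete.comp (comap_measurable _)

theorem DependsOnPrefix.mono {β : Type*} {m n : ℕ} (hmn : m ≤ n) {F : (ℕ → ℕ) → β}
    (h : DependsOnPrefix m F) : DependsOnPrefix n F :=
  fun s t hst => h s t fun i hi => hst i (hi.trans_le hmn)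

theorem DependsOnPrefix.measurable {β : Type*} [MeasurableSpace β] {n : ℕ} {F : (ℕ → ℕ) → β}
    (h : DependsOnPrefix n F) : Measurable F :=
  (h.mono n.le_succ).measurable_piLE.mono (Filtration.piLE.le n) le_rfl

/-- The Markov-type property of the restaurant: given the first `n + 1` customers, the table of
the next customer follows `crpNext`. -/
theorem lintegral_crpLaw_step (q : PYParams) (n : ℕ) (G : (ℕ → ℕ) → ℕ → ℝ≥0∞)
    (hG : ∀ x, DependsOnPrefix (n + 1) fun s => G s x) :
    ∫⁻ s, G s (s (n + 1)) ∂(crpLaw q) =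
      ∫⁻ s, ∫⁻ x, G s x ∂(crpNext q n (Preorder.frestrictLe (π := fun _ => ℕ) n s))
        ∂(crpLaw q) := by
  let E : (Finset.Iic n → ℕ) → ℕ → ℕ := fun h i =>
    if hi : i ∈ Finset.Iic n then h ⟨i, hi⟩ else 0
  have hE : ∀ s x, G s x = G (E (Preorder.frestrictLe (π := fun _ => ℕ) n s)) x := by
    intro s x
    refine hG x _ _ fun i hi => ?_
    simp [E, Nat.le_of_lt_succ hi]
  have key := Kernel.map_frestrictLe_trajMeasure_compProd_eq_map_trajMeasure
    (X := fun _ => ℕ) (μ₀ := Measure.dirac 0) (κ := crpKernel q) (a := n)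
  have hm : Measurable fun p : (Finset.Iic n → ℕ) × ℕ => G (E p.1) p.2 := Measurable.of_discrete
  have hfr : Measurable (Preorder.frestrictLe (π := fun _ : ℕ => ℕ) n) := by fun_prop
  calc ∫⁻ s, G s (s (n + 1)) ∂(crpLaw q)
      = ∫⁻ s, G (E (Preorder.frestrictLe (π := fun _ => ℕ) n s)) (s (n + 1)) ∂(crpLaw q) := by
        simp_rw [← hE]
    _ = ∫⁻ p, G (E p.1) p.2 ∂((crpLaw q).map fun s =>
          (Preorder.frestrictLe (π := fun _ => ℕ) n s, s (n + 1))) := by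
        rw [lintegral_map hm (by fun_prop)]
    _ = ∫⁻ p, G (E p.1) p.2 ∂(((crpLaw q).map
          (Preorder.frestrictLe (π := fun _ => ℕ) n)).compProd (crpKernel q n)) := by
        rw [show crpLaw q = Kernel.trajMeasure (X := fun _ => ℕ) (Measure.dirac 0) (crpKernel q)
          from rfl, key]
    _ = ∫⁻ s, ∫⁻ x, G (E (Preorder.frestrictLe (π := fun _ => ℕ) n s)) x
          ∂(crpNext q n (Preorder.frestrictLe (π := fun _ => ℕ) n s)) ∂(crpLaw q) := by
        rw [Measure.lintegral_compProd hm, lintegral_map Measurable.of_discrete hfr]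
        rfl
    _ = _ := by simp_rw [← hE]

theorem PYParams.add_pos (q : PYParams) {n : ℕ} (hn : 1 ≤ n) : 0 < (n : ℝ) + q.β := by
  have h1 := q.α_lt_one
  have h2 := q.neg_α_lt_β
  have : (1 : ℝ) ≤ n := by exact_mod_cast hn
  linarith

theorem PYParams.add_mul_pos (q : PYParams) {m : ℕ} (hm : 1 ≤ m) : 0 < q.β + q.α * m := by
  have h1 := q.α_nonneg
  have h2 := q.neg_α_lt_β
  have : (1 : ℝ) ≤ m := by exact_mod_cast hm
  nlinarith

/-- The lower bound for the probability of joining a set of occupied tables. It is an inequality,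
because in a history whose tables are not numbered in the order of opening the number of the new
table may already be taken. -/
theorem crpNext_apply_finset_ge (q : PYParams) (s : ℕ → ℕ) (n : ℕ) {J : Finset ℕ}
    (hJ : J ⊆ occ s (n + 1)) :
    ENNReal.ofReal ((∑ k ∈ J, (cnt s (n + 1) k : ℝ) - q.α * J.card) / (n + 1 + q.β)) ≤
      crpNext q n (Preorder.frestrictLe (π := fun _ => ℕ) n s) J := by
  have hden := q.add_pos (n := n + 1) (by omega)
  push_cast at hden
  have hnn : ∀ k ∈ J, 0 ≤ ((cnt s (n + 1) k : ℝ) - q.α) / (n + 1 + q.β) := by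
    intro k hk
    have : (1 : ℝ) ≤ cnt s (n + 1) k := by exact_mod_cast cnt_pos (hJ hk)
    exact div_nonneg (by linarith [q.α_lt_one]) hden.le
  rw [crpNext, occupiedTables_frestrictLe, Measure.add_apply, Measure.finsetSum_apply]
  refine le_trans ?_ le_self_add
  calc ENNReal.ofReal ((∑ k ∈ J, (cnt s (n + 1) k : ℝ) - q.α * J.card) / (n + 1 + q.β))
      = ∑ k ∈ J, ENNReal.ofReal (((cnt s (n + 1) k : ℝ) - q.α) / (n + 1 + q.β)) := by
        rw [← ENNReal.ofReal_sum_of_nonneg hnn, ← Finset.sum_div, Finset.sum_sub_distrib]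
        simp [mul_comm]
    _ ≤ ∑ k ∈ J, (ENNReal.ofReal ((tableCount (Preorder.frestrictLe (π := fun _ => ℕ) n s) k
          - q.α) / (n + 1 + q.β)) • Measure.dirac k) (J : Set ℕ) := by
        refine Finset.sum_le_sum fun k hk => ?_
        rw [tableCount_frestrictLe]
        simp [Measure.dirac_apply_of_mem (Finset.mem_coe.2 hk)]
    _ ≤ _ := Finset.sum_le_sum_of_subset hJ

/-- The next customer avoids a set `J` of occupied tables with probability at most
`(T + β + α |J|) / (n + 1 + β)`, where `T` counts the customers outside `J`. -/
theorem crpNext_apply_compl_le (q : PYParams) (s : ℕ → ℕ) (n : ℕ) {J : Finset ℕ}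
    (hJ : J ⊆ occ s (n + 1)) :
    crpNext q n (Preorder.frestrictLe (π := fun _ => ℕ) n s) (J : Set ℕ)ᶜ ≤
      ENNReal.ofReal ((cntOutside s (n + 1) J + (q.β + q.α * J.card)) / (n + 1 + q.β)) := by
  have hden := q.add_pos (n := n + 1) (by omega)
  push_cast at hden
  have := isProbabilityMeasure_crpNext q n (Preorder.frestrictLe (π := fun _ => ℕ) n s)
  have hsum : ∑ k ∈ J, (cnt s (n + 1) k : ℝ) + cntOutside s (n + 1) J = n + 1 := by
    exact_mod_cast sum_cnt_add_cntOutside s (n + 1) J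
  have hnn : 0 ≤ (∑ k ∈ J, (cnt s (n + 1) k : ℝ) - q.α * J.card) / (n + 1 + q.β) := by
    refine div_nonneg ?_ hden.le
    have : (J.card : ℝ) ≤ ∑ k ∈ J, (cnt s (n + 1) k : ℝ) := by
      rw [Finset.card_eq_sum_ones]; push_cast
      exact Finset.sum_le_sum fun k hk => by exact_mod_cast cnt_pos (hJ hk)
    nlinarith [q.α_lt_one, q.α_nonneg, (J.card.cast_nonneg : (0 : ℝ) ≤ J.card)]
  rw [prob_compl_eq_one_sub J.measurableSet]
  refine (tsub_le_tsub_left (crpNext_apply_finset_ge q s n hJ) 1).trans_eq ?_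
  rw [← ENNReal.ofReal_one, ← ENNReal.ofReal_sub _ hnn]
  congr 1
  rw [eq_div_iff hden.ne', sub_mul, div_mul_cancel₀ _ hden.ne']
  linarith

/-! ### Convergence of the table proportions -/

/-- The martingale of table `k`, started when the table is opened:
`(N_k - α) / (n + 1 + β)` after `n + 1` customers, and `0` while the table is empty. -/
def tableMart (q : PYParams) (k n : ℕ) (s : ℕ → ℕ) : ℝ :=
  (cnt s (n + 1) k - if k ∈ occ s (n + 1) then q.α else 0) / (n + 1 + q.β)

theorem dependsOnPrefix_tableMart (q : PYParams) (k n : ℕ) :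
    DependsOnPrefix (n + 1) (tableMart q k n) := fun s t h => by
  have h1 : occ s (n + 1) = occ t (n + 1) := dependsOnPrefix_occ _ s t h
  have h2 : cnt s (n + 1) k = cnt t (n + 1) k := dependsOnPrefix_cnt _ k s t h
  simp only [tableMart, h1, h2]

theorem PYParams.add_one_pos (q : PYParams) (n : ℕ) : 0 < (n : ℝ) + 1 + q.β := by
  have := q.add_pos (n := n + 1) (by omega); push_cast at this; exact this

theorem tableMart_nonneg (q : PYParams) (k n : ℕ) (s : ℕ → ℕ) : 0 ≤ tableMart q k n s := by
  refine div_nonneg ?_ (q.add_one_pos n).le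
  split_ifs with h
  · have : (1 : ℝ) ≤ cnt s (n + 1) k := by exact_mod_cast cnt_pos h
    linarith [q.α_lt_one]
  · simp

/-- The ratio `(n + 1) / (n + 1 + β)` is bounded in `n`. -/
theorem PYParams.le_mul_add (q : PYParams) (n : ℕ) :
    (n : ℝ) + 1 ≤ (1 + |q.β| / (1 + q.β)) * (n + 1 + q.β) := by
  have h0 : 0 < 1 + q.β := by simpa [add_comm] using q.add_one_pos 0
  have h1 : |q.β| ≤ |q.β| / (1 + q.β) * (n + 1 + q.β) := by
    rw [div_mul_eq_mul_div, le_div_iff₀ h0]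
    refine mul_le_mul_of_nonneg_left ?_ (abs_nonneg _)
    linarith [n.cast_nonneg (α := ℝ)]
  linarith [neg_abs_le q.β]

theorem tableMart_le (q : PYParams) (k n : ℕ) (s : ℕ → ℕ) :
    tableMart q k n s ≤ 1 + |q.β| / (1 + q.β) := by
  rw [tableMart, div_le_iff₀ (q.add_one_pos n)]
  refine le_trans ?_ (q.le_mul_add n)
  have : (cnt s (n + 1) k : ℝ) ≤ n + 1 := by exact_mod_cast cnt_le s (n + 1) k
  have h0 : (0 : ℝ) ≤ if k ∈ occ s (n + 1) then q.α else 0 := by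
    split_ifs
    exacts [q.α_nonneg, le_rfl]
  linarith

theorem tableMart_le_lintegral_succ (q : PYParams) (k n : ℕ) {A : Set (ℕ → ℕ)}
    (hA : DependsOnPrefix (n + 1) fun s => s ∈ A) (hAm : MeasurableSet A) :
    ∫⁻ s in A, ENNReal.ofReal (tableMart q k n s) ∂(crpLaw q) ≤
      ∫⁻ s in A, ENNReal.ofReal (tableMart q k (n + 1) s) ∂(crpLaw q) := by
  classical
  -- `tableMart q k (n + 1)` as a function of the first `n + 1` customers and the next table
  let G : (ℕ → ℕ) → ℕ → ℝ≥0∞ := fun s x => A.indicator (fun _ => ENNReal.ofReal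
    (((cnt s (n + 1) k : ℝ) + (if x = k then 1 else 0) -
      if k ∈ insert x (occ s (n + 1)) then q.α else 0) / (n + 1 + 1 + q.β))) s
  have hG : ∀ x, DependsOnPrefix (n + 1) fun s => G s x := by
    intro x s t h
    have h1 : occ s (n + 1) = occ t (n + 1) := dependsOnPrefix_occ _ s t h
    have h2 : cnt s (n + 1) k = cnt t (n + 1) k := dependsOnPrefix_cnt _ k s t h
    have h3 : (s ∈ A) = (t ∈ A) := hA s t h
    simp only [G, Set.indicator, h1, h2, h3]
  have hstep := lintegral_crpLaw_step q n G hG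
  have hGs : ∀ s, G s (s (n + 1)) =
      A.indicator (fun s => ENNReal.ofReal (tableMart q k (n + 1) s)) s := by
    intro s
    simp only [G, Set.indicator, tableMart, occ_succ s (n + 1), cnt_succ s (n + 1)]
    push_cast
    rfl
  simp_rw [hGs] at hstep
  rw [← lintegral_indicator hAm, ← lintegral_indicator hAm, hstep]
  refine lintegral_mono fun s => ?_
  by_cases hs : s ∈ A
  swap
  · simp [hs]
  simp only [Set.indicator_of_mem hs, G]
  have := isProbabilityMeasure_crpNext q n (Preorder.frestrictLe (π := fun _ => ℕ) n s)
  by_cases hk : k ∈ occ s (n + 1)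
  swap
  · have : tableMart q k n s = 0 := by simp [tableMart, hk, cnt_eq_zero hk]
    simp [this]
  simp only [Finset.mem_insert_of_mem hk, if_true]
  have hc1 : (1 : ℝ) ≤ cnt s (n + 1) k := by exact_mod_cast cnt_pos hk
  have hd := q.add_one_pos n
  have hd1 : 0 < (n : ℝ) + 1 + 1 + q.β := by linarith
  have ha : 0 ≤ (cnt s (n + 1) k : ℝ) - q.α := by linarith [q.α_lt_one]
  have hsplit : ∀ x, ENNReal.ofReal (((cnt s (n + 1) k : ℝ) + (if x = k then 1 else 0) - q.α) /
        (n + 1 + 1 + q.β)) =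
      ENNReal.ofReal (((cnt s (n + 1) k : ℝ) - q.α) / (n + 1 + 1 + q.β)) +
        ({k} : Set ℕ).indicator (fun _ => ENNReal.ofReal (1 / (n + 1 + 1 + q.β))) x := by
    intro x
    by_cases hx : x = k
    · simp only [hx, if_true, Set.mem_singleton_iff, Set.indicator_of_mem]
      rw [← ENNReal.ofReal_add (by positivity) (by positivity)]
      congr 1; ring
    · simp [hx]
  simp_rw [hsplit]
  rw [lintegral_add_left measurable_const, lintegral_const, measure_univ, mul_one,
    lintegral_indicator_const (measurableSet_singleton k)]
  have hge := crpNext_apply_finset_ge q s n (J := {k}) (by simpa using hk)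
  simp only [Finset.sum_singleton, Finset.card_singleton, Nat.cast_one, mul_one,
    Finset.coe_singleton] at hge
  refine le_trans ?_ (add_le_add_right (mul_le_mul_right hge _) _)
  rw [← ENNReal.ofReal_mul (by positivity), ← ENNReal.ofReal_add (by positivity) (by positivity)]
  refine ENNReal.ofReal_le_ofReal (le_of_eq ?_)
  simp only [tableMart, hk, if_true]
  field_simp
  ring

/-- The opening of the table makes an upward jump, so the process is a submartingale. -/
theorem submartingale_tableMart (q : PYParams) (k : ℕ) :
    Submartingale (tableMart q k) (Filtration.piLE (X := fun _ : ℕ => ℕ)) (crpLaw q) := by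
  have hint : ∀ n, Integrable (tableMart q k n) (crpLaw q) := fun n =>
    Integrable.of_bound (C := 1 + |q.β| / (1 + q.β))
      (dependsOnPrefix_tableMart q k n).measurable.aestronglyMeasurable
      (ae_of_all _ fun s => by
        rw [Real.norm_of_nonneg (tableMart_nonneg q k n s)]; exact tableMart_le q k n s)
  refine submartingale_of_setIntegral_le_succ
    (fun n => (dependsOnPrefix_tableMart q k n).measurable_piLE.stronglyMeasurable) hint ?_
  intro n A hA
  have hAm : MeasurableSet A := Filtration.piLE.le n A hA
  have hAd : DependsOnPrefix (n + 1) fun s => s ∈ A := by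
    rw [Filtration.piLE_eq_comap_frestrictLe] at hA
    obtain ⟨B, -, rfl⟩ := hA
    intro s t h
    have : Preorder.frestrictLe (π := fun _ => ℕ) n s = Preorder.frestrictLe n t := by
      funext i
      exact h i (Nat.lt_succ_of_le (Finset.mem_Iic.1 i.2))
    simp only [Set.mem_preimage, this]
  rw [integral_eq_lintegral_of_nonneg_ae (ae_of_all _ (tableMart_nonneg q k n))
      (hint n).aestronglyMeasurable.restrict,
    integral_eq_lintegral_of_nonneg_ae (ae_of_all _ (tableMart_nonneg q k (n + 1)))
      (hint (n + 1)).aestronglyMeasurable.restrict]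
  refine ENNReal.toReal_mono ?_ (tableMart_le_lintegral_succ q k n hAd hAm)
  exact ((hint (n + 1)).integrableOn (s := A)).lintegral_lt_top.ne

theorem ae_tendsto_cnt_div (q : PYParams) (k : ℕ) :
    ∀ᵐ s ∂(crpLaw q), ∃ c : ℝ, Tendsto (fun n : ℕ => (cnt s n k : ℝ) / n) atTop (𝓝 c) := by
  have hconv := (submartingale_tableMart q k).exists_ae_tendsto_of_bdd
    (R := Real.toNNReal (1 + |q.β| / (1 + q.β))) fun n => by
      refine (eLpNorm_le_of_ae_bound (C := 1 + |q.β| / (1 + q.β)) (ae_of_all _ fun s => by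
        rw [Real.norm_of_nonneg (tableMart_nonneg q k n s)]; exact tableMart_le q k n s)).trans ?_
      simp [ENNReal.ofReal]
  filter_upwards [hconv] with s ⟨c, hc⟩
  refine ⟨c, (tendsto_add_atTop_iff_nat 1).1 ?_⟩
  have h1 : Tendsto (fun n : ℕ => 1 / ((n : ℝ) + 1)) atTop (𝓝 0) :=
    tendsto_one_div_add_atTop_nhds_zero_nat
  have h2 : Tendsto (fun n : ℕ => 1 + q.β * (1 / ((n : ℝ) + 1))) atTop (𝓝 1) := by
    simpa using (h1.const_mul q.β).const_add 1
  have h3 : Tendsto (fun n : ℕ => (if k ∈ occ s (n + 1) then q.α else 0) * (1 / ((n : ℝ) + 1)))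
      atTop (𝓝 0) := by
    refine squeeze_zero (g := fun n : ℕ => q.α * (1 / ((n : ℝ) + 1))) (fun n => ?_) (fun n => ?_)
      (by simpa using h1.const_mul q.α)
    · refine mul_nonneg ?_ (by positivity)
      split_ifs
      exacts [q.α_nonneg, le_rfl]
    · refine mul_le_mul_of_nonneg_right ?_ (by positivity)
      split_ifs
      exacts [le_rfl, q.α_nonneg]
  have h4 := (hc.mul h2).add h3
  rw [mul_one, add_zero] at h4
  refine h4.congr fun n => ?_
  have := q.add_one_pos n
  have : (0 : ℝ) < n + 1 := by positivity
  simp only [tableMart]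
  push_cast
  field_simp
  ring

/-- Almost surely, `crpWeight s k` is the limit of the relative sizes of table `k`. -/
theorem ae_tendsto_crpWeight (q : PYParams) :
    ∀ᵐ s ∂(crpLaw q), ∀ k,
      Tendsto (fun n : ℕ => (cnt s n k : ℝ≥0∞) / n) atTop (𝓝 (crpWeight s k)) := by
  rw [ae_all_iff]
  intro k
  filter_upwards [ae_tendsto_cnt_div q k] with s ⟨c, hc⟩
  have h1 : Tendsto (fun n : ℕ => (cnt s n k : ℝ≥0∞) / n) atTop (𝓝 (ENNReal.ofReal c)) := by
    refine ((ENNReal.continuous_ofReal.tendsto c).comp hc).congr' ?_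
    filter_upwards [eventually_gt_atTop 0] with n hn
    simp [ENNReal.ofReal_div_of_pos (Nat.cast_pos.2 hn : (0 : ℝ) < n)]
  have h2 : crpWeight s k = ENNReal.ofReal c := by
    unfold crpWeight
    simp_rw [tableCount_fin]
    exact h1.limsup_eq
  rwa [h2]

/-! ### Expected number of tables and expected unseen mass -/

/-- The expected number of tables occupied by the first `n` customers. -/
def meanTables (q : PYParams) (n : ℕ) : ℝ≥0∞ := ∫⁻ s, ((occ s n).card : ℝ≥0∞) ∂(crpLaw q)

/-- The expectation of `(β + α K) / (n + β)`, the conditional probability that the customer after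
the first `n` opens a new table. -/
def newTableProb (q : PYParams) (n : ℕ) : ℝ≥0∞ :=
  ∫⁻ s, ENNReal.ofReal ((q.β + q.α * (occ s n).card) / (n + q.β)) ∂(crpLaw q)

/-- The asymptotic proportion of the tables that are not among those of the first `n` customers. -/
def unseenMass (s : ℕ → ℕ) (n : ℕ) : ℝ≥0∞ := 1 - ∑ k ∈ occ s n, crpWeight s k

theorem measurable_card_occ (n : ℕ) : Measurable fun s : ℕ → ℕ => ((occ s n).card : ℝ≥0∞) := by
  have h : DependsOnPrefix n fun s => ((occ s n).card : ℝ≥0∞) := fun s t hst => by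
    have h1 : occ s n = occ t n := dependsOnPrefix_occ n s t hst
    simp only [h1]
  exact h.measurable

theorem cntOutside_occ_self (s : ℕ → ℕ) (n : ℕ) : cntOutside s n (occ s n) = 0 := by
  rw [cntOutside, Finset.card_eq_zero, Finset.filter_eq_empty_iff]
  intro i hi h
  exact h (Finset.mem_image_of_mem _ hi)

theorem meanTables_succ_le (q : PYParams) {n : ℕ} (hn : 1 ≤ n) :
    meanTables q (n + 1) ≤ meanTables q n + newTableProb q n := by
  obtain ⟨n, rfl⟩ : ∃ m, n = m + 1 := ⟨n - 1, by omega⟩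
  have hstep := lintegral_crpLaw_step q n (fun s x => ((insert x (occ s (n + 1))).card : ℝ≥0∞))
    fun x s t hst => by
      have h1 : occ s (n + 1) = occ t (n + 1) := dependsOnPrefix_occ _ s t hst
      simp only [h1]
  simp_rw [← occ_succ] at hstep
  rw [meanTables, hstep, meanTables, newTableProb, ← lintegral_add_left (measurable_card_occ _)]
  refine lintegral_mono fun s => ?_
  have := isProbabilityMeasure_crpNext q n (Preorder.frestrictLe (π := fun _ => ℕ) n s)
  have hle : ∀ x, ((insert x (occ s (n + 1))).card : ℝ≥0∞) ≤
      (occ s (n + 1)).card + ((occ s (n + 1) : Set ℕ)ᶜ).indicator (fun _ => 1) x := by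
    intro x
    by_cases hx : x ∈ occ s (n + 1)
    · simp [hx]
    · rw [Finset.card_insert_of_notMem hx, Set.indicator_of_mem (by simpa using hx)]
      push_cast; exact le_rfl
  refine (lintegral_mono hle).trans ?_
  rw [lintegral_add_left measurable_const, lintegral_const, measure_univ, mul_one,
    lintegral_indicator_const (Finset.measurableSet _).compl, one_mul]
  refine add_le_add_right ?_ _
  refine (crpNext_apply_compl_le q s n subset_rfl).trans_eq ?_
  rw [cntOutside_occ_self]
  push_cast
  rw [zero_add]

/-- Customers outside the tables that the first `N` customers occupy arrive like the balls of one
colour of a Pólya urn. -/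
theorem lintegral_cntOutside_le (q : PYParams) {N n : ℕ} (hN : 1 ≤ N) (hn : N ≤ n) :
    ∫⁻ s, ((cntOutside s n (occ s N) : ℝ≥0∞) +
        ENNReal.ofReal (q.β + q.α * (occ s N).card)) ∂(crpLaw q) ≤
      newTableProb q N * ENNReal.ofReal (n + q.β) := by
  have hmc : ∀ n, N ≤ n → DependsOnPrefix n fun s => (cntOutside s n (occ s N) : ℝ≥0∞) +
        ENNReal.ofReal (q.β + q.α * (occ s N).card) := fun n hn s t hst => by
    have h1 : occ s N = occ t N := dependsOnPrefix_occ N s t fun i hi => hst i (hi.trans_le hn)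
    have h2 : cntOutside s n (occ s N) = cntOutside t n (occ t N) :=
      dependsOnPrefix_cntOutside hn s t hst
    simp only [h2]
    simp only [h1]
  induction n, hn using Nat.le_induction with
  | base =>
    have hNβ := q.add_pos hN
    rw [newTableProb, ← lintegral_mul_const' _ _ ENNReal.ofReal_ne_top]
    refine lintegral_mono fun s => ?_
    have := q.add_mul_pos (card_occ_pos s hN)
    rw [cntOutside_occ_self, ← ENNReal.ofReal_mul (by positivity), div_mul_cancel₀ _ hNβ.ne']
    simp
  | succ n hn ih =>
    obtain ⟨n, rfl⟩ : ∃ m, n = m + 1 := ⟨n - 1, by omega⟩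
    have hd := q.add_one_pos n
    have hstep := lintegral_crpLaw_step q n (fun s x => (cntOutside s (n + 1) (occ s N) : ℝ≥0∞) +
        ENNReal.ofReal (q.β + q.α * (occ s N).card) + if x ∈ occ s N then 0 else 1)
      fun x s t hst => by
        have h1 : occ s N = occ t N := dependsOnPrefix_occ N s t fun i hi => hst i (by omega)
        have h2 : cntOutside s (n + 1) (occ s N) = cntOutside t (n + 1) (occ t N) :=
          dependsOnPrefix_cntOutside hn s t hst
        simp only [h2]
        simp only [h1]
    have hsplit : ∀ s : ℕ → ℕ, (cntOutside s (n + 1 + 1) (occ s N) : ℝ≥0∞) +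
        ENNReal.ofReal (q.β + q.α * (occ s N).card) =
        (cntOutside s (n + 1) (occ s N) : ℝ≥0∞) +
        ENNReal.ofReal (q.β + q.α * (occ s N).card) +
          if s (n + 1) ∈ occ s N then 0 else 1 := by
      intro s
      rw [cntOutside_succ]
      push_cast
      rw [add_right_comm]
    simp_rw [hsplit]
    rw [hstep]
    have hpt : ∀ s : ℕ → ℕ, ∫⁻ x, ((cntOutside s (n + 1) (occ s N) : ℝ≥0∞) +
        ENNReal.ofReal (q.β + q.α * (occ s N).card) + if x ∈ occ s N then 0 else 1)
          ∂(crpNext q n (Preorder.frestrictLe (π := fun _ => ℕ) n s)) ≤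
        ((cntOutside s (n + 1) (occ s N) : ℝ≥0∞) +
        ENNReal.ofReal (q.β + q.α * (occ s N).card)) *
          ENNReal.ofReal (1 + 1 / (n + 1 + q.β)) := by
      intro s
      have := isProbabilityMeasure_crpNext q n (Preorder.frestrictLe (π := fun _ => ℕ) n s)
      have hind : ∀ x, (if x ∈ occ s N then (0 : ℝ≥0∞) else 1) =
          ((occ s N : Set ℕ)ᶜ).indicator (fun _ => 1) x := by
        intro x
        by_cases hx : x ∈ occ s N <;> simp [hx]
      simp_rw [hind]
      rw [lintegral_add_left measurable_const, lintegral_const, measure_univ, mul_one,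
        lintegral_indicator_const (Finset.measurableSet _).compl, one_mul]
      have hpos := q.add_mul_pos (card_occ_pos s hN)
      refine (add_le_add_right (crpNext_apply_compl_le q s n (occ_mono s hn)) _).trans_eq ?_
      rw [← ENNReal.ofReal_natCast, ← ENNReal.ofReal_add (by positivity) hpos.le,
        ← ENNReal.ofReal_add (by positivity) (by positivity),
        ← ENNReal.ofReal_mul (by positivity)]
      congr 1
      ring
    refine (lintegral_mono hpt).trans ?_
    rw [lintegral_mul_const' _ _ ENNReal.ofReal_ne_top]
    refine (mul_le_mul_left ih _).trans_eq ?_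
    rw [mul_assoc, ← ENNReal.ofReal_mul (by push_cast; positivity)]
    congr 2
    push_cast
    field_simp
    ring

theorem ae_tendsto_unseenMass (q : PYParams) (N : ℕ) :
    ∀ᵐ s ∂(crpLaw q), Tendsto (fun n : ℕ => (cntOutside s n (occ s N) : ℝ≥0∞) / n) atTop
      (𝓝 (unseenMass s N)) := by
  filter_upwards [ae_tendsto_crpWeight q] with s hs
  have h1 : Tendsto (fun n : ℕ => 1 - ∑ k ∈ occ s N, (cnt s n k : ℝ≥0∞) / n) atTop
      (𝓝 (unseenMass s N)) :=
    ENNReal.Tendsto.sub tendsto_const_nhds (tendsto_finsetSum _ fun k _ => hs k)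
      (Or.inl ENNReal.one_ne_top)
  refine h1.congr' ?_
  filter_upwards [eventually_gt_atTop 0] with n hn
  have hn0 : (n : ℝ≥0∞) ≠ 0 := by exact_mod_cast hn.ne'
  have hsum : (cntOutside s n (occ s N) : ℝ≥0∞) / n + ∑ k ∈ occ s N, (cnt s n k : ℝ≥0∞) / n
      = 1 := by
    simp_rw [div_eq_mul_inv]
    rw [← Finset.sum_mul, ← add_mul, add_comm]
    have : ((∑ k ∈ occ s N, cnt s n k + cntOutside s n (occ s N) : ℕ) : ℝ≥0∞) = n := by
      rw [sum_cnt_add_cntOutside]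
    push_cast at this
    rw [this, ENNReal.mul_inv_cancel hn0 (ENNReal.natCast_ne_top n)]
  refine (ENNReal.eq_sub_of_add_eq ?_ hsum).symm
  exact ne_top_of_le_ne_top ENNReal.one_ne_top (hsum ▸ le_add_self)

/-- Fatou's lemma along the proportions of the customers outside the first tables. -/
theorem lintegral_unseenMass_le (q : PYParams) {N : ℕ} (hN : 1 ≤ N) :
    ∫⁻ s, unseenMass s N ∂(crpLaw q) ≤ newTableProb q N := by
  have hlim : Tendsto (fun n : ℕ => newTableProb q N * ENNReal.ofReal ((n + q.β) / n)) atTop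
      (𝓝 (newTableProb q N * ENNReal.ofReal 1)) := by
    refine ENNReal.Tendsto.const_mul ?_ (Or.inl (by simp))
    refine (ENNReal.continuous_ofReal.tendsto 1).comp ?_
    have h1 : Tendsto (fun n : ℕ => 1 + q.β * (n : ℝ)⁻¹) atTop (𝓝 1) := by
      simpa using (tendsto_inv_atTop_nhds_zero_nat (𝕜 := ℝ)).const_mul q.β |>.const_add 1
    refine h1.congr' ?_
    filter_upwards [eventually_gt_atTop 0] with n hn
    have : (0 : ℝ) < n := by exact_mod_cast hn
    field_simp
  have hm : ∀ n, Measurable fun s : ℕ → ℕ => (cntOutside s (n + N) (occ s N) : ℝ≥0∞) / (n + N : ℕ) :=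
    fun n => by
      have h : DependsOnPrefix (n + N) fun s : ℕ → ℕ =>
          (cntOutside s (n + N) (occ s N) : ℝ≥0∞) / (n + N : ℕ) := fun s t hst => by
        have h2 : cntOutside s (n + N) (occ s N) = cntOutside t (n + N) (occ t N) :=
          dependsOnPrefix_cntOutside (Nat.le_add_left N n) s t hst
        simp only [h2]
      exact h.measurable
  calc ∫⁻ s, unseenMass s N ∂(crpLaw q)
      = ∫⁻ s, liminf (fun n : ℕ =>
          (cntOutside s (n + N) (occ s N) : ℝ≥0∞) / (n + N : ℕ)) atTop ∂(crpLaw q) := by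
        refine lintegral_congr_ae ?_
        filter_upwards [ae_tendsto_unseenMass q N] with s hs
        exact ((tendsto_add_atTop_iff_nat N).2 hs).liminf_eq.symm
    _ ≤ liminf (fun n : ℕ => ∫⁻ s, (cntOutside s (n + N) (occ s N) : ℝ≥0∞) / (n + N : ℕ)
          ∂(crpLaw q)) atTop := lintegral_liminf_le hm
    _ ≤ liminf (fun n : ℕ => newTableProb q N * ENNReal.ofReal (((n + N : ℕ) + q.β) / (n + N : ℕ)))
          atTop := by
        refine liminf_le_liminf (Eventually.of_forall fun n => ?_)
        have hpos : (0 : ℝ) < (n + N : ℕ) := by exact_mod_cast (by omega : 0 < n + N)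
        have hc : ((n + N : ℕ) : ℝ≥0∞)⁻¹ ≠ ∞ := by
          simp only [ne_eq, ENNReal.inv_eq_top]; exact_mod_cast (by omega : n + N ≠ 0)
        simp_rw [div_eq_mul_inv]
        rw [lintegral_mul_const' _ _ hc, ENNReal.ofReal_mul' (by positivity),
          ENNReal.ofReal_inv_of_pos hpos, ENNReal.ofReal_natCast, ← mul_assoc]
        refine mul_le_mul_left (le_trans ?_
          (lintegral_cntOutside_le q hN (Nat.le_add_left N n))) _
        exact lintegral_mono fun s => le_self_add
    _ = newTableProb q N := by
        rw [((tendsto_add_atTop_iff_nat N).2 hlim).liminf_eq]; simp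

theorem newTableProb_le (q : PYParams) {n : ℕ} (hn : 1 ≤ n) :
    newTableProb q n ≤ ENNReal.ofReal (|q.β| / (n + q.β)) +
      ENNReal.ofReal (q.α / (n + q.β)) * meanTables q n := by
  have hd := q.add_pos hn
  have hα := q.α_nonneg
  rw [newTableProb, meanTables, ← lintegral_const_mul' _ _ ENNReal.ofReal_ne_top]
  calc _ ≤ ∫⁻ s, (ENNReal.ofReal (|q.β| / (n + q.β)) +
        ENNReal.ofReal (q.α / (n + q.β)) * (occ s n).card) ∂(crpLaw q) := by
        refine lintegral_mono fun s => ?_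
        rw [← ENNReal.ofReal_natCast, ← ENNReal.ofReal_mul (by positivity),
          ← ENNReal.ofReal_add (by positivity) (by positivity)]
        refine ENNReal.ofReal_le_ofReal ?_
        rw [add_div, mul_div_right_comm]
        gcongr
        exact le_abs_self _
    _ = _ := by rw [lintegral_add_left measurable_const]; simp

/-! ### Growth of the number of tables -/

/-- The comparison function for the expected number of tables: it dominates the recursion
`b (n + 1) = b n (1 + α / (n + β)) + |β| / (n + β)` from `n = 2` on. -/
def tableBound (q : PYParams) (n : ℕ) : ℝ :=
  (n + q.β - 1) ^ q.α * (2 / (1 + q.β) ^ q.α +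
    |q.β| / (1 + q.β) ^ q.α * Real.log ((n + q.β - 1) / (1 + q.β)))

theorem tableBound_succ_ge (q : PYParams) {n : ℕ} (hn : 2 ≤ n) :
    tableBound q n * (1 + q.α / (n + q.β)) + |q.β| / (n + q.β) ≤ tableBound q (n + 1) := by
  have hα := q.α_nonneg
  have hα1 := q.α_lt_one
  have h0 : 0 < 1 + q.β := by simpa [add_comm] using q.add_one_pos 0
  have hn2 : (2 : ℝ) ≤ n := by exact_mod_cast hn
  have hx : 0 < (n : ℝ) + q.β - 1 := by linarith
  have hx1 : 0 < (n : ℝ) + q.β := by linarith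
  unfold tableBound
  push_cast
  rw [show (n : ℝ) + 1 + q.β - 1 = n + q.β by ring]
  set x : ℝ := n + q.β
  have hL : 0 ≤ Real.log ((x - 1) / (1 + q.β)) :=
    Real.log_nonneg ((one_le_div h0).2 (by simp only [x]; linarith))
  -- Bernoulli's inequality, used as `(1 - 1 / x) ^ α ≤ 1 - α / x`
  have hf : (x - 1) ^ q.α * (1 + q.α / x) ≤ x ^ q.α := by
    have h1 : (1 + -(1 / x)) ^ q.α ≤ 1 + q.α * -(1 / x) :=
      rpow_one_add_le_one_add_mul_self
        (by rw [neg_le_neg_iff, div_le_one hx1]; linarith) hα hα1.le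
    have h2 : x - 1 = x * (1 + -(1 / x)) := by field_simp; ring
    have h3 : 0 ≤ 1 + -(1 / x) := by
      rw [← sub_eq_add_neg, sub_nonneg, div_le_one hx1]; linarith
    rw [h2, Real.mul_rpow hx1.le h3, mul_assoc]
    refine mul_le_of_le_one_right (by positivity) ?_
    calc (1 + -(1 / x)) ^ q.α * (1 + q.α / x)
        ≤ (1 + q.α * -(1 / x)) * (1 + q.α / x) :=
          mul_le_mul_of_nonneg_right h1 (by positivity)
      _ = 1 - (q.α / x) ^ 2 := by ring
      _ ≤ 1 := by linarith [sq_nonneg (q.α / x)]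
  have hlog : Real.log ((x - 1) / (1 + q.β)) + 1 / x ≤ Real.log (x / (1 + q.β)) := by
    have h1 := Real.one_sub_inv_le_log_of_pos (x := x / (x - 1)) (by positivity)
    rw [Real.log_div hx1.ne' hx.ne'] at h1
    rw [Real.log_div hx.ne' h0.ne', Real.log_div hx1.ne' h0.ne']
    have : 1 - (x / (x - 1))⁻¹ = 1 / x := by field_simp; ring
    linarith
  have hE : |q.β| / x ≤ x ^ q.α * (|q.β| / (1 + q.β) ^ q.α * (1 / x)) := by
    have h1 : (1 + q.β) ^ q.α ≤ x ^ q.α :=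
      Real.rpow_le_rpow h0.le (by simp only [x]; linarith) hα
    have h2 : 0 < (1 + q.β) ^ q.α := Real.rpow_pos_of_pos h0 _
    rw [show x ^ q.α * (|q.β| / (1 + q.β) ^ q.α * (1 / x)) =
      |q.β| / x * (x ^ q.α / (1 + q.β) ^ q.α) by ring]
    exact le_mul_of_one_le_right (by positivity) ((one_le_div h2).2 h1)
  set L := Real.log ((x - 1) / (1 + q.β))
  set E := |q.β| / (1 + q.β) ^ q.α
  set D := 2 / (1 + q.β) ^ q.α
  have hE0 : 0 ≤ E := by positivity
  have hD0 : 0 ≤ D := by positivity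
  calc (x - 1) ^ q.α * (D + E * L) * (1 + q.α / x) + |q.β| / x
      = (x - 1) ^ q.α * (1 + q.α / x) * (D + E * L) + |q.β| / x := by ring
    _ ≤ x ^ q.α * (D + E * L) + x ^ q.α * (E * (1 / x)) :=
        add_le_add (mul_le_mul_of_nonneg_right hf (by positivity)) hE
    _ = x ^ q.α * (D + E * (L + 1 / x)) := by ring
    _ ≤ _ := by gcongr

theorem tableBound_nonneg (q : PYParams) {n : ℕ} (hn : 2 ≤ n) : 0 ≤ tableBound q n := by
  have h0 : 0 < 1 + q.β := by simpa [add_comm] using q.add_one_pos 0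
  have hn2 : (2 : ℝ) ≤ n := by exact_mod_cast hn
  have hL : 0 ≤ Real.log ((n + q.β - 1) / (1 + q.β)) :=
    Real.log_nonneg ((one_le_div h0).2 (by linarith))
  have : 0 ≤ (n : ℝ) + q.β - 1 := by linarith
  unfold tableBound
  positivity

theorem meanTables_le_tableBound (q : PYParams) {n : ℕ} (hn : 2 ≤ n) :
    meanTables q n ≤ ENNReal.ofReal (tableBound q n) := by
  have h0 : 0 < 1 + q.β := by simpa [add_comm] using q.add_one_pos 0
  have hα := q.α_nonneg
  induction n, hn using Nat.le_induction with
  | base =>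
    have h2 : tableBound q 2 = 2 := by
      have : (0 : ℝ) < (1 + q.β) ^ q.α := Real.rpow_pos_of_pos h0 _
      rw [tableBound, show ((2 : ℕ) : ℝ) + q.β - 1 = 1 + q.β by push_cast; ring, div_self h0.ne']
      simp only [Real.log_one, mul_zero, add_zero]
      field_simp
    rw [h2, meanTables]
    refine (lintegral_mono (g := fun _ => 2) fun s => ?_).trans ?_
    · have := card_occ_le s 2
      exact (Nat.cast_le (α := ℝ≥0∞)).2 this
    · simp
  | succ n hn ih =>
    have hd := q.add_pos (show 1 ≤ n by omega)
    have hb := tableBound_nonneg q hn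
    refine (meanTables_succ_le q (by omega)).trans ?_
    refine (add_le_add ih ((newTableProb_le q (by omega)).trans
      (add_le_add_right (mul_le_mul_right ih _) _))).trans ?_
    rw [← ENNReal.ofReal_mul (by positivity), ← ENNReal.ofReal_add (by positivity) (by positivity),
      ← ENNReal.ofReal_add (by positivity) (by positivity)]
    refine ENNReal.ofReal_le_ofReal (le_trans (le_of_eq ?_) (tableBound_succ_ge q hn))
    ring

theorem exists_meanTables_le (q : PYParams) :
    ∃ C : ℝ, 0 ≤ C ∧ ∀ n : ℕ, 1 ≤ n →
      meanTables q n ≤ ENNReal.ofReal (C * ((n : ℝ) ^ q.α * (1 + Real.log n))) := by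
  have h0 : 0 < 1 + q.β := by simpa [add_comm] using q.add_one_pos 0
  have hα := q.α_nonneg
  have hb : q.β ≤ |q.β| := le_abs_self _
  set D := 2 / (1 + q.β) ^ q.α with hD
  set E := |q.β| / (1 + q.β) ^ q.α with hE
  set c := Real.log ((1 + |q.β|) / (1 + q.β)) with hc
  have hD0 : 0 ≤ D := by positivity
  have hE0 : 0 ≤ E := by positivity
  have hc0 : 0 ≤ c := Real.log_nonneg ((one_le_div h0).2 (by linarith))
  refine ⟨(1 + |q.β|) ^ q.α * (D + E + E * c) + 1, by positivity, fun n hn => ?_⟩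
  have hn1 : (1 : ℝ) ≤ n := by exact_mod_cast hn
  have hlog : 0 ≤ Real.log n := Real.log_nonneg hn1
  rcases hn.eq_or_lt with rfl | hn2
  · refine (lintegral_mono (g := fun _ => 1) fun s => ?_).trans ?_
    · have := (Nat.cast_le (α := ℝ≥0∞)).2 (card_occ_le s 1)
      simpa using this
    · rw [lintegral_const, measure_univ, mul_one]
      simp only [Nat.cast_one, Real.one_rpow, Real.log_one, add_zero, mul_one]
      rw [ENNReal.one_le_ofReal, le_add_iff_nonneg_left]
      positivity
  refine (meanTables_le_tableBound q hn2).trans (ENNReal.ofReal_le_ofReal ?_)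
  have hn2' : (2 : ℝ) ≤ n := by exact_mod_cast hn2
  have hx : 0 < (n : ℝ) + q.β - 1 := by linarith
  have hxle : (n : ℝ) + q.β - 1 ≤ (1 + |q.β|) * n := by
    nlinarith [abs_nonneg q.β]
  have h1 : ((n : ℝ) + q.β - 1) ^ q.α ≤ (1 + |q.β|) ^ q.α * (n : ℝ) ^ q.α := by
    rw [← Real.mul_rpow (by positivity) (by positivity)]
    exact Real.rpow_le_rpow hx.le hxle hα
  have h2 : Real.log ((n + q.β - 1) / (1 + q.β)) ≤ Real.log n + c := by
    rw [hc, ← Real.log_mul (by positivity) (by positivity)]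
    refine Real.log_le_log (by positivity) ?_
    rw [← mul_div_assoc]
    gcongr
    linarith
  have h3 : 0 ≤ Real.log ((n + q.β - 1) / (1 + q.β)) :=
    Real.log_nonneg ((one_le_div h0).2 (by linarith))
  calc tableBound q n ≤ ((1 + |q.β|) ^ q.α * (n : ℝ) ^ q.α) * (D + E * (Real.log n + c)) := by
        rw [tableBound]; gcongr
    _ ≤ ((1 + |q.β|) ^ q.α * (n : ℝ) ^ q.α) * ((D + E + E * c) * (1 + Real.log n)) := by
        gcongr
        nlinarith [mul_nonneg hD0 hlog, mul_nonneg (mul_nonneg hE0 hc0) hlog]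
    _ ≤ _ := by
        have : 0 ≤ (n : ℝ) ^ q.α * (1 + Real.log n) := by positivity
        nlinarith

/-- The expected number of tables and `n` times the expected unseen mass are both of order
`n ^ α`, up to a logarithm. -/
theorem exists_crp_bounds (q : PYParams) :
    ∃ C : ℝ, 0 ≤ C ∧ ∀ n : ℕ, 1 ≤ n →
      meanTables q n ≤ ENNReal.ofReal (C * ((n : ℝ) ^ q.α * (1 + Real.log n))) ∧
      n * ∫⁻ s, unseenMass s n ∂(crpLaw q) ≤
        ENNReal.ofReal (C * ((n : ℝ) ^ q.α * (1 + Real.log n))) := by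
  obtain ⟨C, hC, h⟩ := exists_meanTables_le q
  have hα := q.α_nonneg
  have h0 : 0 < 1 + q.β := by simpa [add_comm] using q.add_one_pos 0
  set B := 1 + |q.β| / (1 + q.β) with hB
  have hB0 : 0 ≤ B := by positivity
  refine ⟨C + B * (|q.β| + q.α * C), by positivity, fun n hn => ?_⟩
  have hn1 : (1 : ℝ) ≤ n := by exact_mod_cast hn
  have hlog : 0 ≤ Real.log n := Real.log_nonneg hn1
  have hpow : 1 ≤ (n : ℝ) ^ q.α := Real.one_le_rpow hn1 hα
  have hd := q.add_pos hn
  set F := (n : ℝ) ^ q.α * (1 + Real.log n)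
  have hF : 1 ≤ F := one_le_mul_of_one_le_of_one_le hpow (by linarith)
  have hratio : (n : ℝ) / (n + q.β) ≤ B := by
    obtain ⟨m, rfl⟩ : ∃ m, n = m + 1 := ⟨n - 1, by omega⟩
    rw [div_le_iff₀ hd]
    have := q.le_mul_add m
    push_cast; exact this
  constructor
  · refine (h n hn).trans (ENNReal.ofReal_le_ofReal ?_)
    have : 0 ≤ B * (|q.β| + q.α * C) * F := by positivity
    linarith
  · calc n * ∫⁻ s, unseenMass s n ∂(crpLaw q)
        ≤ ENNReal.ofReal n * (ENNReal.ofReal (|q.β| / (n + q.β)) +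
            ENNReal.ofReal (q.α / (n + q.β)) * ENNReal.ofReal (C * F)) := by
          rw [ENNReal.ofReal_natCast]
          refine mul_le_mul_right ((lintegral_unseenMass_le q hn).trans
            ((newTableProb_le q hn).trans (add_le_add_right (mul_le_mul_right (h n hn) _) _))) _
      _ = ENNReal.ofReal (n / (n + q.β) * (|q.β| + q.α * (C * F))) := by
          rw [← ENNReal.ofReal_mul (by positivity),
            ← ENNReal.ofReal_add (by positivity) (by positivity),
            ← ENNReal.ofReal_mul (by positivity)]
          congr 1; ring
      _ ≤ _ := by
          refine ENNReal.ofReal_le_ofReal ?_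
          have h1 : n / (n + q.β) * (|q.β| + q.α * (C * F)) ≤ B * (|q.β| + q.α * (C * F)) :=
            mul_le_mul_of_nonneg_right hratio (by positivity)
          have h2 : B * (|q.β| + q.α * (C * F)) ≤ B * (|q.β| + q.α * C) * F := by
            have : B * |q.β| * 1 ≤ B * |q.β| * F := by gcongr
            linarith
          have h3 : 0 ≤ C * F := by positivity
          linarith

/-- The table proportions sum to one: the unseen mass vanishes as the number of customers grows. -/
theorem ae_tsum_crpWeight (q : PYParams) : ∀ᵐ s ∂(crpLaw q), ∑' k, crpWeight s k = 1 := by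
  obtain ⟨C, hC, h⟩ := exists_crp_bounds q
  have hzero : ∫⁻ s, (1 - ∑' k, crpWeight s k) ∂(crpLaw q) = 0 := by
    have hle : ∀ n : ℕ, 1 ≤ n → ∫⁻ s, (1 - ∑' k, crpWeight s k) ∂(crpLaw q) ≤
        ENNReal.ofReal (C * ((n : ℝ) ^ (q.α - 1) * (1 + Real.log n))) := by
      intro n hn
      have hn0 : (0 : ℝ) < n := by exact_mod_cast hn
      have h1 : ∫⁻ s, (1 - ∑' k, crpWeight s k) ∂(crpLaw q) ≤
          ∫⁻ s, unseenMass s n ∂(crpLaw q) :=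
        lintegral_mono fun s => tsub_le_tsub_left (ENNReal.sum_le_tsum _) 1
      refine h1.trans ?_
      have h2 := (h n hn).2
      rw [mul_comm, ← ENNReal.le_div_iff_mul_le (Or.inl (by exact_mod_cast hn0.ne'))
        (Or.inl (ENNReal.natCast_ne_top n)), ← ENNReal.ofReal_natCast,
        ← ENNReal.ofReal_div_of_pos hn0] at h2
      refine h2.trans_eq ?_
      rw [Real.rpow_sub_one hn0.ne']
      congr 1; ring
    have hα1 : 0 < 1 - q.α := by linarith [q.α_lt_one]
    have hlim : Tendsto (fun n : ℕ => ENNReal.ofReal (C * ((n : ℝ) ^ (q.α - 1) *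
        (1 + Real.log n)))) atTop (𝓝 (ENNReal.ofReal (C * 0))) := by
      refine (ENNReal.continuous_ofReal.tendsto _).comp (Tendsto.const_mul C ?_)
      have h1 : Tendsto (fun x : ℝ => x ^ (q.α - 1) * (1 + Real.log x)) atTop (𝓝 0) := by
        have ha : Tendsto (fun x : ℝ => x ^ (q.α - 1)) atTop (𝓝 0) := by
          have := tendsto_rpow_neg_atTop hα1
          rwa [neg_sub] at this
        have hb : Tendsto (fun x : ℝ => Real.log x / x ^ (1 - q.α)) atTop (𝓝 0) :=
          (isLittleO_log_rpow_atTop hα1).tendsto_div_nhds_zero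
        have := ha.add hb
        rw [add_zero] at this
        refine this.congr' ?_
        filter_upwards [eventually_gt_atTop 0] with x hx
        rw [show q.α - 1 = -(1 - q.α) by ring, Real.rpow_neg hx.le]
        ring
      exact h1.comp tendsto_natCast_atTop_atTop
    rw [mul_zero, ENNReal.ofReal_zero] at hlim
    refine le_antisymm (ge_of_tendsto hlim ?_) zero_le
    filter_upwards [eventually_ge_atTop 1] with n hn using hle n hn
  have hmeas : Measurable fun s : ℕ → ℕ => 1 - ∑' k, crpWeight s k :=
    measurable_const.sub (Measurable.tsum fun k => measurable_crpWeight k)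
  rw [lintegral_eq_zero_iff hmeas] at hzero
  filter_upwards [hzero, ae_tendsto_crpWeight q] with s h1 h2
  refine le_antisymm ?_ (tsub_eq_zero_iff_le.1 h1)
  rw [ENNReal.tsum_eq_iSup_sum]
  refine iSup_le fun J => ?_
  refine le_of_tendsto' (tendsto_finsetSum J fun k _ => h2 k) fun n => ?_
  simp_rw [div_eq_mul_inv]
  rw [← Finset.sum_mul, ← div_eq_mul_inv]
  refine ENNReal.div_le_of_le_mul ?_
  rw [one_mul]
  have := sum_cnt_add_cntOutside s n J
  have h3 : ∑ k ∈ J, cnt s n k ≤ n := by omega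
  exact_mod_cast h3

/-! ### A grid on the parameter ball -/

theorem ParamBall.abs_apply_le {d : ℕ} (x : ParamBall d) (i : Fin d) :
    |(x : EuclideanSpace ℝ (Fin d)) i| ≤ 1 := by
  have h1 : ‖(x : EuclideanSpace ℝ (Fin d))‖ ≤ 1 := mem_closedBall_zero_iff.1 x.2
  have h2 := PiLp.norm_apply_le (x : EuclideanSpace ℝ (Fin d)) i
  rw [Real.norm_eq_abs] at h2
  exact h2.trans h1

/-- The cell of a point in the cubic grid of mesh `2 / M` on `[-1, 1]^d`. The last cell in each
coordinate only contains the endpoint `1`. -/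
def gridCell (M : ℕ) {d : ℕ} (x : ParamBall d) : Fin d → Fin (M + 1) := fun i =>
  ⟨⌊((x : EuclideanSpace ℝ (Fin d)) i + 1) / 2 * M⌋₊, by
    have h := abs_le.1 (x.abs_apply_le i)
    refine Nat.lt_succ_of_le (Nat.floor_le_of_le ?_)
    have : (0 : ℝ) ≤ M := M.cast_nonneg
    nlinarith⟩

/-- A point of the parameter ball in the given cell, if there is one, and the origin otherwise. -/
def gridRep (M : ℕ) {d : ℕ} (c : Fin d → Fin (M + 1)) : ParamBall d :=
  open Classical in if h : ∃ x, gridCell M x = c then h.choose else ⟨0, by simp⟩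

theorem gridCell_gridRep (M : ℕ) {d : ℕ} (x : ParamBall d) :
    gridCell M (gridRep M (gridCell M x)) = gridCell M x := by
  have h : ∃ y, gridCell M y = gridCell M x := ⟨x, rfl⟩
  rw [gridRep, dif_pos h]
  exact h.choose_spec

theorem norm_sub_sq_le_of_gridCell_eq {M : ℕ} (hM : 0 < M) {d : ℕ} {x y : ParamBall d}
    (h : gridCell M x = gridCell M y) :
    ‖(x : EuclideanSpace ℝ (Fin d)) - y‖ ^ 2 ≤ d * (4 / (M : ℝ) ^ 2) := by
  have hM' : (0 : ℝ) < M := by exact_mod_cast hM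
  rw [EuclideanSpace.norm_sq_eq]
  calc _ ≤ ∑ _i : Fin d, 4 / (M : ℝ) ^ 2 := ?_
    _ = _ := by simp
  refine Finset.sum_le_sum fun i _ => ?_
  have h1 : ⌊((x : EuclideanSpace ℝ (Fin d)) i + 1) / 2 * M⌋₊ =
      ⌊((y : EuclideanSpace ℝ (Fin d)) i + 1) / 2 * M⌋₊ := congrArg Fin.val (congrFun h i)
  have hx := abs_le.1 (x.abs_apply_le i)
  have hy := abs_le.1 (y.abs_apply_le i)
  have hx1 := Nat.floor_le (a := ((x : EuclideanSpace ℝ (Fin d)) i + 1) / 2 * M)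
    (mul_nonneg (by linarith) hM'.le)
  have hy1 := Nat.floor_le (a := ((y : EuclideanSpace ℝ (Fin d)) i + 1) / 2 * M)
    (mul_nonneg (by linarith) hM'.le)
  have hx2 := Nat.lt_floor_add_one (((x : EuclideanSpace ℝ (Fin d)) i + 1) / 2 * M)
  have hy2 := Nat.lt_floor_add_one (((y : EuclideanSpace ℝ (Fin d)) i + 1) / 2 * M)
  rw [h1] at hx1 hx2
  rw [le_div_iff₀ (by positivity)]
  simp only [PiLp.sub_apply, Real.norm_eq_abs, sq_abs]
  set a := (x : EuclideanSpace ℝ (Fin d)) i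
  set b := (y : EuclideanSpace ℝ (Fin d)) i
  have h3 : |(a - b) * M| ≤ 2 := abs_le.2 ⟨by linarith, by linarith⟩
  calc (a - b) ^ 2 * (M : ℝ) ^ 2 = |(a - b) * M| ^ 2 := by rw [sq_abs]; ring
    _ ≤ 2 ^ 2 := pow_le_pow_left₀ (abs_nonneg _) h3 2
    _ = 4 := by norm_num

/-- The number of grid intervals per coordinate that makes `N` times the divergence between the
laws of two points of one cell at most `d`. -/
def gridSize (N : ℕ) (L : ℝ) : ℕ := ⌈2 * N * L⌉₊ + 1

theorem mul_norm_sub_sq_le {N : ℕ} (hN : 1 ≤ N) {L : ℝ} (hL : 0 < L) {d : ℕ} {x y : ParamBall d}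
    (h : gridCell (gridSize N L) x = gridCell (gridSize N L) y) :
    L * ‖(x : EuclideanSpace ℝ (Fin d)) - y‖ ^ 2 ≤ d / N := by
  have h1 := norm_sub_sq_le_of_gridCell_eq (Nat.succ_pos _) h
  have hM : 2 * N * L + 1 ≤ (gridSize N L : ℝ) := by
    have := Nat.le_ceil (2 * N * L)
    unfold gridSize; push_cast; linarith
  have hN' : (0 : ℝ) < N := by exact_mod_cast hN
  have hNL : 0 < N * L := by positivity
  have hM0 : (0 : ℝ) < gridSize N L := by linarith
  refine (mul_le_mul_of_nonneg_left h1 hL.le).trans ?_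
  change L * (d * (4 / (gridSize N L : ℝ) ^ 2)) ≤ d / N
  rw [le_div_iff₀ hN', show L * (d * (4 / (gridSize N L : ℝ) ^ 2)) * N =
    d * (4 * (N * L) / (gridSize N L : ℝ) ^ 2) by ring]
  refine mul_le_of_le_one_right d.cast_nonneg ((div_le_one (by positivity)).2 ?_)
  nlinarith

theorem log_gridSize_le {N : ℕ} (hN : 1 ≤ N) {L : ℝ} (hL : 0 < L) :
    Real.log (gridSize N L + 1) ≤ 2 + Real.log N + Real.log (1 + L) := by
  have hN' : (1 : ℝ) ≤ N := by exact_mod_cast hN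
  have h1 : (gridSize N L : ℝ) + 1 ≤ 3 * N * (1 + L) := by
    have := Nat.ceil_lt_add_one (a := 2 * N * L) (by positivity)
    unfold gridSize; push_cast
    nlinarith
  have h3 : Real.log 3 ≤ 2 := by
    have := Real.log_le_sub_one_of_pos (x := 3) (by norm_num); linarith
  calc _ ≤ Real.log (3 * N * (1 + L)) := Real.log_le_log (by positivity) h1
    _ = Real.log 3 + Real.log N + Real.log (1 + L) := by
        rw [Real.log_mul (by positivity) (by positivity), Real.log_mul (by norm_num) (by positivity)]
    _ ≤ _ := by linarith

/-! ### Divergence from a truncated and discretized mixture -/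

/-- The finite-sum form of the divergence. Points of zero `Q`-mass contribute `0 * log (0 / 0) = 0`. -/
theorem klDiv_eq_ofReal_sum {K : Type*} [Fintype K] [MeasurableSpace K]
    [DiscreteMeasurableSpace K] {P Q : Measure K} [IsProbabilityMeasure P]
    [IsProbabilityMeasure Q] (hac : P ≪ Q) :
    InformationTheory.klDiv P Q =
      ENNReal.ofReal (∑ x, P.real {x} * Real.log (P.real {x} / Q.real {x})) := by
  rw [InformationTheory.klDiv_of_ac_of_integrable hac (Integrable.of_finite),
    integral_fintype Integrable.of_finite]
  simp only [probReal_univ, add_sub_cancel_right, smul_eq_mul]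
  congr 1
  refine Finset.sum_congr rfl fun x _ => ?_
  have hd : P.rnDeriv Q x * Q {x} = P {x} := by
    conv_rhs => rw [← Measure.withDensity_rnDeriv_eq P Q hac]
    rw [withDensity_apply _ (measurableSet_singleton x), lintegral_singleton]
  by_cases hq : Q {x} = 0
  · have : P.real {x} = 0 := by simp [Measure.real, hac hq]
    rw [this]; simp
  have hq' : 0 < Q.real {x} := ENNReal.toReal_pos hq (measure_ne_top _ _)
  have : (P.rnDeriv Q x).toReal = P.real {x} / Q.real {x} := by
    rw [Measure.real, ← hd, ENNReal.toReal_mul]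
    exact (mul_div_cancel_right₀ _ hq'.ne').symm
  rw [llr, this]

/-- Divergence between a mixture and a code that keeps only finitely many components: the kept
components, with weights `p i` and laws `P i`, are replaced by `p' i` and `P' i`, and all remaining
mass is charged to the constant `u`. -/
theorem sum_mul_log_mixture_le {K ι : Type*} [Fintype K] (J : Finset ι) {M : K → ℝ}
    {p p' : ι → ℝ} {P P' : ι → K → ℝ} {u δ ρ : ℝ} (hM : ∑ x, M x = 1) (hu : 0 < u)
    (hp : ∀ i ∈ J, 0 ≤ p i) (hp' : ∀ i ∈ J, 0 < p' i) (hpp' : ∀ i ∈ J, p i ≤ ρ * p' i)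
    (hP : ∀ i ∈ J, ∀ x, 0 ≤ P i x) (hP' : ∀ i ∈ J, ∀ x, 0 ≤ P' i x)
    (hP1 : ∀ i ∈ J, ∑ x, P i x = 1) (hac : ∀ i ∈ J, ∀ x, P' i x = 0 → P i x = 0)
    (hδ : ∀ i ∈ J, ∑ x, P i x * Real.log (P i x / P' i x) ≤ δ)
    (hMP : ∀ x, ∑ i ∈ J, p i * P i x ≤ M x) :
    ∑ x, M x * Real.log (M x / (∑ i ∈ J, p' i * P' i x + u)) ≤
      (∑ i ∈ J, p i) * (Real.log ρ + δ) + (1 - ∑ i ∈ J, p i) * Real.log (1 / u) := by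
  have hMnn : ∀ x, 0 ≤ M x := fun x =>
    (Finset.sum_nonneg fun i hi => mul_nonneg (hp i hi) (hP i hi x)).trans (hMP x)
  have hM1 : ∀ x, M x ≤ 1 := fun x => hM ▸ Finset.single_le_sum (fun y _ => hMnn y) (Finset.mem_univ x)
  have hx : ∀ x, M x * Real.log (M x / (∑ i ∈ J, p' i * P' i x + u)) ≤
      ∑ i ∈ J, p i * (P i x * Real.log ρ + P i x * Real.log (P i x / P' i x)) +
        (M x - ∑ i ∈ J, p i * P i x) * Real.log (1 / u) := by
    intro x
    set W := M x - ∑ i ∈ J, p i * P i x with hW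
    have hW0 : 0 ≤ W := sub_nonneg.2 (hMP x)
    have hW1 : W ≤ 1 := by
      have := Finset.sum_nonneg fun i hi => mul_nonneg (hp i hi) (hP i hi x)
      linarith [hM1 x]
    -- the unseen mass is the component `none` of the mixture
    have hls := sum_mul_log_div_le (Finset.insertNone J)
      (a := fun o => o.elim W fun i => p i * P i x) (b := fun o => o.elim u fun i => p' i * P' i x)
      (by
        intro o ho
        cases o with
        | none => exact hW0
        | some i =>
          have hi := Finset.some_mem_insertNone.1 ho
          exact mul_nonneg (hp i hi) (hP i hi x))
      (by
        intro o ho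
        cases o with
        | none => exact hu.le
        | some i =>
          have hi := Finset.some_mem_insertNone.1 ho
          exact mul_nonneg (hp' i hi).le (hP' i hi x))
      (by
        intro o ho h
        cases o with
        | none => exact absurd h hu.ne'
        | some i =>
          have hi := Finset.some_mem_insertNone.1 ho
          have h0 : P' i x = 0 := (mul_eq_zero.1 h).resolve_left (hp' i hi).ne'
          simp [hac i hi x h0])
    simp only [Finset.sum_insertNone, Option.elim_none, Option.elim_some] at hls
    rw [show W + ∑ i ∈ J, p i * P i x = M x by rw [hW]; ring, add_comm u] at hls
    refine hls.trans ?_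
    rw [add_comm]
    refine add_le_add (Finset.sum_le_sum fun i hi => ?_) ?_
    · rcases (hp i hi).eq_or_lt with h0 | h0
      · simp [← h0]
      rcases (hP i hi x).eq_or_lt with h1 | h1
      · simp [← h1]
      have h2 : 0 < P' i x := (hP' i hi x).lt_of_ne fun h => h1.ne' (hac i hi x h.symm)
      have h3 := hp' i hi
      have h4 : Real.log (p i * P i x / (p' i * P' i x)) ≤
          Real.log ρ + Real.log (P i x / P' i x) := by
        rw [mul_div_mul_comm, Real.log_mul (by positivity) (by positivity)]
        refine add_le_add_left (Real.log_le_log (by positivity) ?_) _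
        rw [div_le_iff₀ h3]
        exact hpp' i hi
      calc _ ≤ p i * P i x * (Real.log ρ + Real.log (P i x / P' i x)) :=
            mul_le_mul_of_nonneg_left h4 (by positivity)
        _ = _ := by ring
    · rcases hW0.eq_or_lt with h0 | h0
      · simp [← h0]
      refine mul_le_mul_of_nonneg_left (Real.log_le_log (by positivity) ?_) hW0
      gcongr
  refine (Finset.sum_le_sum fun x _ => hx x).trans ?_
  have h1 : ∑ x, ∑ i ∈ J, p i * P i x = ∑ i ∈ J, p i := by
    rw [Finset.sum_comm]
    exact Finset.sum_congr rfl fun i hi => by rw [← Finset.mul_sum, hP1 i hi, mul_one]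
  rw [Finset.sum_add_distrib, ← Finset.sum_mul, Finset.sum_sub_distrib, hM, h1, Finset.sum_comm,
    Finset.sum_mul]
  refine add_le_add_left (Finset.sum_le_sum fun i hi => ?_) _
  rw [← Finset.mul_sum, Finset.sum_add_distrib, ← Finset.sum_mul, hP1 i hi, one_mul]
  exact mul_le_mul_of_nonneg_left (add_le_add_right (hδ i hi) _) (hp i hi)

/-! ### Discretized mixtures -/

/-- The normalizing constant of the discretized weights. -/
def codeNorm {N m : ℕ} {A : Type*} (c : Fin m → A × Fin (N + 1)) : ℕ :=
  ∑ i, ((c i).2 + 1 : ℕ) + 1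

/-- The law encoded by `m` grid cells and `m` integer weights: a mixture of the laws of the cell
representatives and of the uniform law, the latter with the weight of one unit. -/
def codeLaw {K : Type*} [Fintype K] [MeasurableSpace K] {d N M m : ℕ}
    (knw : Kernel (ParamBall d) K) (c : Fin m → (Fin d → Fin (M + 1)) × Fin (N + 1)) :
    Measure K :=
  ∑ i, (((((c i).2 + 1 : ℕ) : ℝ≥0∞) / codeNorm c) • knw (gridRep M (c i).1)) +
    ((codeNorm c * Fintype.card K : ℕ) : ℝ≥0∞)⁻¹ • Measure.count

theorem codeNorm_pos {N m : ℕ} {A : Type*} (c : Fin m → A × Fin (N + 1)) : 0 < codeNorm c :=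
  Nat.succ_pos _

theorem nonempty_of_markov {d : ℕ} {K : Type*} [MeasurableSpace K] (knw : Kernel (ParamBall d) K)
    [IsMarkovKernel knw] : Nonempty K :=
  nonempty_of_isProbabilityMeasure (knw ⟨0, by simp⟩)

theorem isProbabilityMeasure_codeLaw {K : Type*} [Fintype K] [MeasurableSpace K]
    [DiscreteMeasurableSpace K] {d N M m : ℕ} (knw : Kernel (ParamBall d) K) [IsMarkovKernel knw]
    (c : Fin m → (Fin d → Fin (M + 1)) × Fin (N + 1)) : IsProbabilityMeasure (codeLaw knw c) := by
  have := nonempty_of_markov knw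
  have hS : (codeNorm c : ℝ≥0∞) ≠ 0 := by exact_mod_cast (codeNorm_pos c).ne'
  have hS' : (codeNorm c : ℝ≥0∞) ≠ ∞ := ENNReal.natCast_ne_top _
  have hK : (Fintype.card K : ℝ≥0∞) ≠ 0 := by exact_mod_cast Fintype.card_ne_zero
  refine ⟨?_⟩
  rw [codeLaw, Measure.add_apply, Measure.finsetSum_apply]
  simp only [Measure.smul_apply, measure_univ, smul_eq_mul, mul_one]
  rw [Measure.count_univ, ENat.card_eq_coe_fintype_card]
  simp_rw [div_eq_mul_inv]
  rw [← Finset.sum_mul, Nat.cast_mul, ENNReal.mul_inv (Or.inl hS) (Or.inl hS'), mul_assoc]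
  have h1 : (Fintype.card K : ℝ≥0∞)⁻¹ * ((Fintype.card K : ℕ∞) : ℝ≥0∞) = 1 := by
    rw [ENat.toENNReal_coe]
    exact ENNReal.inv_mul_cancel hK (ENNReal.natCast_ne_top _)
  rw [h1, mul_one, ← add_one_mul, ← div_eq_mul_inv]
  have h2 : ∑ i, (((c i).2 + 1 : ℕ) : ℝ≥0∞) + 1 = codeNorm c := by
    unfold codeNorm; push_cast; rfl
  rw [h2, ENNReal.div_self hS hS']

theorem codeLaw_real_singleton {K : Type*} [Fintype K] [MeasurableSpace K]
    [DiscreteMeasurableSpace K] {d N M m : ℕ} (knw : Kernel (ParamBall d) K) [IsMarkovKernel knw]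
    (c : Fin m → (Fin d → Fin (M + 1)) × Fin (N + 1)) (x : K) :
    (codeLaw knw c).real {x} =
      ∑ i, ((((c i).2 + 1 : ℕ) : ℝ) / codeNorm c) * (knw (gridRep M (c i).1)).real {x} +
        ((codeNorm c * Fintype.card K : ℕ) : ℝ)⁻¹ := by
  have := nonempty_of_markov knw
  have hS : (codeNorm c : ℝ≥0∞) ≠ 0 := by exact_mod_cast (codeNorm_pos c).ne'
  have hK : Fintype.card K ≠ 0 := Fintype.card_ne_zero
  have hSK : ((codeNorm c * Fintype.card K : ℕ) : ℝ≥0∞) ≠ 0 := by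
    exact_mod_cast mul_ne_zero (codeNorm_pos c).ne' hK
  have hterm : ∀ i, ((((c i).2 + 1 : ℕ) : ℝ≥0∞) / codeNorm c) * knw (gridRep M (c i).1) {x} ≠ ∞ :=
    fun i => ENNReal.mul_ne_top (ENNReal.div_ne_top (ENNReal.natCast_ne_top _) hS)
      (measure_ne_top _ _)
  rw [Measure.real, codeLaw, Measure.add_apply, Measure.finsetSum_apply]
  simp only [Measure.smul_apply, smul_eq_mul, Measure.count_singleton, mul_one]
  rw [ENNReal.toReal_add (ENNReal.sum_ne_top.2 fun i _ => hterm i) (ENNReal.inv_ne_top.2 hSK),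
    ENNReal.toReal_sum fun i _ => hterm i, ENNReal.toReal_inv, ENNReal.toReal_natCast]
  congr 1
  refine Finset.sum_congr rfl fun i _ => ?_
  rw [ENNReal.toReal_mul, ENNReal.toReal_div, ENNReal.toReal_natCast, ENNReal.toReal_natCast,
    Measure.real]

theorem pyMixture_bind_apply {d : ℕ} {K : Type*} [MeasurableSpace K]
    (knw : Kernel (ParamBall d) K) (s : ℕ → ℕ) (θ : ℕ → ParamBall d) {A : Set K}
    (hA : MeasurableSet A) :
    (pyMixture (s, θ)).bind knw A = ∑' k, crpWeight s k * knw (θ k) A := by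
  rw [Measure.bind_apply hA knw.measurable.aemeasurable, pyMixture, lintegral_sum_measure]
  simp only [lintegral_smul_measure, smul_eq_mul]
  exact tsum_congr fun k => by rw [lintegral_dirac' _ (knw.measurable_coe hA)]

theorem isProbabilityMeasure_pyMixture_bind {d : ℕ} {K : Type*} [MeasurableSpace K]
    (knw : Kernel (ParamBall d) K) [IsMarkovKernel knw] {s : ℕ → ℕ} (θ : ℕ → ParamBall d)
    (hs : ∑' k, crpWeight s k = 1) : IsProbabilityMeasure ((pyMixture (s, θ)).bind knw) :=
  ⟨by rw [pyMixture_bind_apply knw s θ MeasurableSet.univ]; simpa using hs⟩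

/-- The knowledge model is approximated by keeping the tables that the first `N` customers
occupy. -/
theorem exists_codeLaw_klDiv_le {d : ℕ} {K : Type*} [Fintype K] [MeasurableSpace K]
    [DiscreteMeasurableSpace K] (knw : Kernel (ParamBall d) K) [IsMarkovKernel knw] {L : ℝ}
    (hL : 0 < L)
    (hKL : ∀ φ₁ φ₂ : ParamBall d, InformationTheory.klDiv (knw φ₁) (knw φ₂) ≤
      ENNReal.ofReal (L * ‖(φ₁ : EuclideanSpace ℝ (Fin d)) - φ₂‖ ^ 2))
    {N : ℕ} (hN : 1 ≤ N) {s : ℕ → ℕ} (hs : ∑' k, crpWeight s k = 1) (θ : ℕ → ParamBall d) :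
    ∃ c : Fin (occ s N).card → (Fin d → Fin (gridSize N L + 1)) × Fin (N + 1),
      N * InformationTheory.klDiv ((pyMixture (s, θ)).bind knw) (codeLaw knw c) ≤
        ENNReal.ofReal (2 + d) * (occ s N).card +
          ENNReal.ofReal (Real.log (2 * N + 1) + Real.log (Fintype.card K)) *
            (N * unseenMass s N) := by
  classical
  have := nonempty_of_markov knw
  have hprob := isProbabilityMeasure_pyMixture_bind knw θ hs
  have hN' : (1 : ℝ) ≤ N := by exact_mod_cast hN
  have hN0 : (0 : ℝ) < N := by linarith
  set m := (occ s N).card with hm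
  have hm1 : (1 : ℝ) ≤ m := by exact_mod_cast card_occ_pos s hN
  have hmN : (m : ℝ) ≤ N := by exact_mod_cast card_occ_le s N
  let e : Fin m ≃ occ s N := (occ s N).equivFin.symm
  have hsumE : ∀ f : ℕ → ℝ≥0∞, ∑ i, f (e i) = ∑ k ∈ occ s N, f k := fun f => by
    rw [← Finset.sum_coe_sort (occ s N) f]
    exact Equiv.sum_comp e fun k => f k
  have hwt : ∀ k, crpWeight s k ≤ 1 := fun k => hs ▸ ENNReal.le_tsum k
  have hwt' : ∀ k, crpWeight s k ≠ ∞ := fun k => ne_top_of_le_ne_top ENNReal.one_ne_top (hwt k)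
  let p : Fin m → ℝ := fun i => (crpWeight s (e i)).toReal
  have hp0 : ∀ i, 0 ≤ p i := fun i => ENNReal.toReal_nonneg
  have hsumle : ∑ k ∈ occ s N, crpWeight s k ≤ 1 := hs ▸ ENNReal.sum_le_tsum _
  have hsump : ∑ i, p i = (∑ k ∈ occ s N, crpWeight s k).toReal := by
    rw [← hsumE, ENNReal.toReal_sum fun i _ => hwt' _]
  have hsump1 : ∑ i, p i ≤ 1 := by
    rw [hsump]; exact ENNReal.toReal_le_of_le_ofReal zero_le_one (by simpa using hsumle)
  have hp1 : ∀ i, p i ≤ 1 := fun i =>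
    (Finset.single_le_sum (fun j _ => hp0 j) (Finset.mem_univ i)).trans hsump1
  have hunseen : unseenMass s N = ENNReal.ofReal (1 - ∑ i, p i) := by
    rw [unseenMass, hsump, ENNReal.ofReal_sub _ ENNReal.toReal_nonneg, ENNReal.ofReal_one,
      ENNReal.ofReal_toReal (ne_top_of_le_ne_top ENNReal.one_ne_top hsumle)]
  -- rounding `N p` down and adding one unit keeps each weight above `p` up to the factor
  -- `codeNorm c / N`
  let c : Fin m → (Fin d → Fin (gridSize N L + 1)) × Fin (N + 1) := fun i =>
    (gridCell (gridSize N L) (θ (e i)), ⟨⌊N * p i⌋₊, by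
      refine Nat.lt_succ_of_le (Nat.floor_le_of_le ?_)
      exact mul_le_of_le_one_right hN0.le (hp1 i)⟩)
  refine ⟨c, ?_⟩
  have hcode := isProbabilityMeasure_codeLaw knw c
  have hS0 : (0 : ℝ) < codeNorm c := by exact_mod_cast codeNorm_pos c
  have hK0 : (1 : ℝ) ≤ Fintype.card K := by exact_mod_cast Fintype.card_pos
  have hSle : (codeNorm c : ℝ) ≤ N + m + 1 := by
    have h1 : (codeNorm c : ℝ) = ∑ i, ((⌊N * p i⌋₊ : ℝ) + 1) + 1 := by
      simp [codeNorm, c]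
    rw [h1]
    have h2 : ∑ i, ((⌊N * p i⌋₊ : ℝ) + 1) ≤ ∑ i, (N * p i + 1) :=
      Finset.sum_le_sum fun i _ => add_le_add_left (Nat.floor_le (by have := hp0 i; positivity)) _
    have h4 : ∑ i, (N * p i + 1) = N * ∑ i, p i + m := by
      rw [Finset.sum_add_distrib, ← Finset.mul_sum]; simp
    have h3 : N * ∑ i, p i ≤ N := mul_le_of_le_one_right hN0.le hsump1
    linarith
  have hpair : ∀ i, InformationTheory.klDiv (knw (θ (e i))) (knw (gridRep (gridSize N L) (c i).1))
      ≤ ENNReal.ofReal (d / N) := fun i =>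
    (hKL _ _).trans (ENNReal.ofReal_le_ofReal
      (mul_norm_sub_sq_le hN hL (gridCell_gridRep _ _).symm))
  have hpac : ∀ i, knw (θ (e i)) ≪ knw (gridRep (gridSize N L) (c i).1) := fun i =>
    (InformationTheory.klDiv_ne_top_iff.1
      (ne_top_of_le_ne_top ENNReal.ofReal_ne_top (hpair i))).1
  have hac : (pyMixture (s, θ)).bind knw ≪ codeLaw knw c := by
    -- the uniform component gives every point positive mass
    have h0 : ∀ x, codeLaw knw c {x} ≠ 0 := by
      intro x h
      have h1 := codeLaw_real_singleton knw c x
      rw [Measure.real, h, ENNReal.toReal_zero] at h1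
      have h2 : (0 : ℝ) < ((codeNorm c * Fintype.card K : ℕ) : ℝ)⁻¹ := by
        push_cast; positivity
      have h3 : 0 ≤ ∑ i, ((((c i).2 + 1 : ℕ) : ℝ) / codeNorm c) *
          (knw (gridRep (gridSize N L) (c i).1)).real {x} :=
        Finset.sum_nonneg fun i _ => by positivity
      linarith
    intro A hA
    have : A = ∅ := by
      by_contra hne
      obtain ⟨x, hx⟩ := Set.nonempty_iff_ne_empty.2 hne
      exact h0 x (measure_mono_null (Set.singleton_subset_iff.2 hx) hA)
    simp [this]
  have hmain := sum_mul_log_mixture_le (Finset.univ : Finset (Fin m))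
    (M := fun x => ((pyMixture (s, θ)).bind knw).real {x}) (p := p)
    (p' := fun i => (((c i).2 + 1 : ℕ) : ℝ) / codeNorm c)
    (P := fun i x => (knw (θ (e i))).real {x})
    (P' := fun i x => (knw (gridRep (gridSize N L) (c i).1)).real {x})
    (u := ((codeNorm c * Fintype.card K : ℕ) : ℝ)⁻¹) (δ := d / N) (ρ := codeNorm c / N)
    (by simp) (by push_cast; positivity) (fun i _ => hp0 i)
    (fun i _ => by positivity)
    (fun i _ => by
      have h1 := Nat.lt_floor_add_one (N * p i)
      have h2 : (codeNorm c : ℝ) / N * ((((c i).2 + 1 : ℕ) : ℝ) / codeNorm c) =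
          ((⌊N * p i⌋₊ : ℝ) + 1) / N := by
        change (codeNorm c : ℝ) / N * (((⌊N * p i⌋₊ + 1 : ℕ) : ℝ) / codeNorm c) = _
        push_cast; field_simp
      rw [h2, le_div_iff₀ hN0]
      linarith)
    (fun i _ x => measureReal_nonneg) (fun i _ x => measureReal_nonneg)
    (fun i _ => by simp)
    (fun i _ x h => by
      have h1 : knw (gridRep (gridSize N L) (c i).1) {x} = 0 :=
        (measureReal_eq_zero_iff (measure_ne_top _ _)).1 h
      simp [Measure.real, hpac i h1])
    (fun i _ => by
      have h1 := hpair i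
      rw [klDiv_eq_ofReal_sum (hpac i)] at h1
      exact (ENNReal.ofReal_le_ofReal_iff (by positivity)).1 h1)
    (fun x => by
      have h1 : ∑ i, crpWeight s (e i) * knw (θ (e i)) {x} ≤
          (pyMixture (s, θ)).bind knw {x} := by
        rw [pyMixture_bind_apply knw s θ (measurableSet_singleton x),
          hsumE fun k => crpWeight s k * knw (θ k) {x}]
        exact ENNReal.sum_le_tsum _
      have h2 := ENNReal.toReal_mono (measure_ne_top _ _) h1
      rw [ENNReal.toReal_sum fun i _ => ENNReal.mul_ne_top (hwt' _) (measure_ne_top _ _)] at h2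
      simp only [ENNReal.toReal_mul] at h2
      exact h2)
  rw [klDiv_eq_ofReal_sum hac, hunseen]
  simp_rw [codeLaw_real_singleton knw c]
  have hlogS : Real.log (codeNorm c / N) ≤ (m + 1) / N := by
    refine (Real.log_le_sub_one_of_pos (by positivity)).trans ?_
    rw [sub_le_iff_le_add, div_add_one hN0.ne']
    gcongr
    linarith
  have hlogu : Real.log (1 / ((codeNorm c * Fintype.card K : ℕ) : ℝ)⁻¹) ≤
      Real.log (2 * N + 1) + Real.log (Fintype.card K) := by
    rw [← Real.log_mul (by positivity) (by positivity), one_div, inv_inv]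
    refine Real.log_le_log (by push_cast; positivity) ?_
    push_cast
    gcongr
    linarith
  have hlog1 : 0 ≤ Real.log (2 * N + 1) := Real.log_nonneg (by linarith)
  have hlog2 : 0 ≤ Real.log (Fintype.card K) := Real.log_nonneg hK0
  have hfin : (∑ i, p i) * (Real.log (codeNorm c / N) + d / N) ≤ (m + 1) / N + d / N := by
    have h1 : 0 ≤ ∑ i, p i := Finset.sum_nonneg fun i _ => hp0 i
    have h2 : (0 : ℝ) ≤ (m + 1) / N + d / N := by positivity
    calc _ ≤ (∑ i, p i) * ((m + 1) / N + d / N) :=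
          mul_le_mul_of_nonneg_left (add_le_add_left hlogS _) h1
      _ ≤ _ := mul_le_of_le_one_left h2 hsump1
  have hunn : 0 ≤ 1 - ∑ i, p i := sub_nonneg.2 hsump1
  rw [← ENNReal.ofReal_natCast, ← ENNReal.ofReal_natCast, ← ENNReal.ofReal_mul hN0.le,
    ← ENNReal.ofReal_mul (by positivity), ← ENNReal.ofReal_mul hN0.le,
    ← ENNReal.ofReal_mul (by positivity), ← ENNReal.ofReal_add (by positivity) (by positivity)]
  refine ENNReal.ofReal_le_ofReal ?_
  refine (mul_le_mul_of_nonneg_left (hmain.trans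
    (add_le_add hfin (mul_le_mul_of_nonneg_left hlogu hunn))) hN0.le).trans ?_
  rw [mul_add]
  refine add_le_add ?_ (le_of_eq (by ring))
  rw [mul_add, mul_div_cancel₀ _ hN0.ne', mul_div_cancel₀ _ hN0.ne']
  nlinarith [(d.cast_nonneg : (0 : ℝ) ≤ d)]

/-! ### The code of the knowledge model -/

theorem negLog_inv_natCast {n : ℕ} (hn : 0 < n) :
    negLog ((n : ℝ≥0∞)⁻¹) = ENNReal.ofReal (Real.log n) := by
  rw [negLog_eq_ofReal (ENNReal.inv_ne_zero.2 (ENNReal.natCast_ne_top n))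
    (ENNReal.inv_ne_top.2 (by exact_mod_cast hn.ne')), ENNReal.toReal_inv,
    ENNReal.toReal_natCast, Real.log_inv, neg_neg]

/-- Every law `P ω` is described by one of finitely many laws `Q j`, with prior weights `w j`, such
that the code length `-log (w j)` plus `N` times the divergence is at most `cost ω`. -/
def HasCode {Ω K : Type*} [MeasurableSpace K] (N : ℕ) (P : Ω → Measure K) (cost : Ω → ℝ≥0∞) :
    Prop :=
  ∃ (ι : Type) (_ : Fintype ι) (w : ι → ℝ≥0∞) (Q : ι → Measure K),
    ∑ j, w j = 1 ∧ (∀ j, IsProbabilityMeasure (Q j)) ∧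
      ∀ ω, ∃ j, negLog (w j) + N * InformationTheory.klDiv (P ω) (Q j) ≤ cost ω

/-- The cost of describing the knowledge model: each table seen by the first `N` customers costs
one cell of the grid and one integer weight, and each unit of unseen mass costs a uniform code. -/
def knwCost (d N k : ℕ) (L : ℝ) (s : ℕ → ℕ) : ℝ≥0∞ :=
  ENNReal.ofReal (d * Real.log (gridSize N L + 1) + 2 * Real.log (N + 1) + 2 + d) *
      (occ s N).card +
    ENNReal.ofReal (Real.log (2 * N + 1) + Real.log k) * (N * unseenMass s N)

theorem hasCode_knowledge {d : ℕ} {K : Type*} [Fintype K] [MeasurableSpace K]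
    [DiscreteMeasurableSpace K] (knw : Kernel (ParamBall d) K) [IsMarkovKernel knw] {L : ℝ}
    (hL : 0 < L)
    (hKL : ∀ φ₁ φ₂ : ParamBall d, InformationTheory.klDiv (knw φ₁) (knw φ₂) ≤
      ENNReal.ofReal (L * ‖(φ₁ : EuclideanSpace ℝ (Fin d)) - φ₂‖ ^ 2))
    {N : ℕ} (hN : 1 ≤ N) :
    HasCode N (Ω := {s : ℕ → ℕ // ∑' k, crpWeight s k = 1} × (ℕ → ParamBall d))
      (fun ω => (pyMixture ((ω.1 : ℕ → ℕ), ω.2)).bind knw)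
      (fun ω => knwCost d N (Fintype.card K) L ω.1) := by
  classical
  -- the number of tables is coded uniformly on `{0, …, N}`, then each table uniformly on `A`
  let A : Type := (Fin d → Fin (gridSize N L + 1)) × Fin (N + 1)
  refine ⟨Σ m : Fin (N + 1), (Fin m → A), inferInstance,
    fun j => (((N + 1) * Fintype.card (Fin j.1 → A) : ℕ) : ℝ≥0∞)⁻¹,
    fun j => codeLaw knw j.2, ?_, fun j => isProbabilityMeasure_codeLaw knw j.2, ?_⟩
  · rw [Fintype.sum_sigma]
    have h1 : ∀ m : Fin (N + 1), ∑ _c : Fin m → A,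
        (((N + 1) * Fintype.card (Fin m → A) : ℕ) : ℝ≥0∞)⁻¹ = ((N + 1 : ℕ) : ℝ≥0∞)⁻¹ := by
      intro m
      have h0 : ((Fintype.card (Fin m → A) : ℕ) : ℝ≥0∞) ≠ 0 := by
        exact_mod_cast Fintype.card_ne_zero
      rw [Finset.sum_const, Finset.card_univ, nsmul_eq_mul, Nat.cast_mul,
        ENNReal.mul_inv (Or.inr (ENNReal.natCast_ne_top _)) (Or.inr h0), mul_left_comm,
        ENNReal.mul_inv_cancel h0 (ENNReal.natCast_ne_top _), mul_one]
    simp_rw [h1]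
    rw [Finset.sum_const, Finset.card_univ, Fintype.card_fin, nsmul_eq_mul,
      ENNReal.mul_inv_cancel (by exact_mod_cast Nat.succ_ne_zero N) (ENNReal.natCast_ne_top _)]
  · rintro ⟨⟨s, hs⟩, θ⟩
    obtain ⟨c, hc⟩ := exists_codeLaw_klDiv_le knw hL hKL hN hs θ
    refine ⟨⟨⟨(occ s N).card, Nat.lt_succ_of_le (card_occ_le s N)⟩, c⟩, ?_⟩
    have hm1 : (1 : ℝ) ≤ (occ s N).card := by exact_mod_cast card_occ_pos s hN
    rw [negLog_inv_natCast (Nat.mul_pos (Nat.succ_pos N) Fintype.card_pos)]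
    refine (add_le_add_right hc _).trans ?_
    rw [← add_assoc]
    unfold knwCost
    refine add_le_add_left ?_ _
    have hl1 : 0 ≤ Real.log ((N : ℝ) + 1) := Real.log_nonneg (by simp)
    have hl2 : 0 ≤ Real.log ((gridSize N L : ℝ) + 1) := Real.log_nonneg (by simp)
    rw [← ENNReal.ofReal_natCast (occ s N).card, ← ENNReal.ofReal_mul (by positivity),
      ← ENNReal.ofReal_mul (by positivity), ← ENNReal.ofReal_add
        (Real.log_natCast_nonneg _) (by positivity)]
    refine ENNReal.ofReal_le_ofReal ?_
    have hcard : Real.log (((N + 1) * Fintype.card (Fin (occ s N).card → A) : ℕ) : ℝ) =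
        Real.log (N + 1) + (occ s N).card *
          (d * Real.log (gridSize N L + 1) + Real.log (N + 1)) := by
      have h1 : Fintype.card (Fin (occ s N).card → A) =
          ((gridSize N L + 1) ^ d * (N + 1)) ^ (occ s N).card := by
        simp [A]
      rw [h1]
      push_cast
      rw [Real.log_mul (by positivity) (by positivity), Real.log_pow,
        Real.log_mul (by positivity) (by positivity), Real.log_pow]
    rw [hcard]
    nlinarith

/-! ### Expected cost of the codes -/

theorem measurable_unseenMass (n : ℕ) : Measurable fun s : ℕ → ℕ => unseenMass s n := by
  classical
  have h : ∀ s : ℕ → ℕ, unseenMass s n =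
      1 - ∑' k, {s : ℕ → ℕ | k ∈ occ s n}.indicator (fun s => crpWeight s k) s := by
    intro s
    rw [unseenMass, tsum_eq_sum (s := occ s n) fun k hk => by simp [hk]]
    congr 1
    exact Finset.sum_congr rfl fun k hk => by simp [hk]
  simp_rw [h]
  refine measurable_const.sub (Measurable.tsum fun k => (measurable_crpWeight k).indicator ?_)
  have h1 : DependsOnPrefix n fun s : ℕ → ℕ => k ∈ occ s n := fun s t hst => by
    have h2 : occ s n = occ t n := dependsOnPrefix_occ n s t hst
    simp only [h2]
  exact measurableSet_setOfPred.2 h1.measurable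

theorem measurable_knwCost (d N k : ℕ) (L : ℝ) : Measurable (knwCost d N k L) :=
  ((measurable_card_occ N).const_mul _).add (((measurable_unseenMass N).const_mul _).const_mul _)

/-- The logarithmic factor of the knowledge part. -/
def knwLog (d N k : ℕ) (L : ℝ) : ℝ :=
  1 + Real.log N + Real.log k + Real.log (1 + d) + Real.log (1 + L)

theorem log_add_one_le {N : ℕ} (hN : 1 ≤ N) : Real.log ((N : ℝ) + 1) ≤ 1 + Real.log N := by
  have hN' : (1 : ℝ) ≤ N := by exact_mod_cast hN
  have h2 : Real.log 2 ≤ 1 := by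
    have := Real.log_le_sub_one_of_pos (x := 2) (by norm_num); linarith
  calc _ ≤ Real.log (2 * N) := Real.log_le_log (by positivity) (by linarith)
    _ = Real.log 2 + Real.log N := Real.log_mul (by norm_num) (by positivity)
    _ ≤ _ := by linarith

theorem lintegral_knwCost_le {q : PYParams} {C : ℝ} (hC : 0 ≤ C) {d N k : ℕ} {L : ℝ}
    (hd : 1 ≤ d) (hN : 1 ≤ N) (hL : 0 < L) (hk : 1 ≤ k)
    (h1 : meanTables q N ≤ ENNReal.ofReal (C * ((N : ℝ) ^ q.α * (1 + Real.log N))))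
    (h2 : N * ∫⁻ s, unseenMass s N ∂(crpLaw q) ≤
      ENNReal.ofReal (C * ((N : ℝ) ^ q.α * (1 + Real.log N)))) :
    ∫⁻ s, knwCost d N k L s ∂(crpLaw q) ≤
      ENNReal.ofReal (9 * C * (knwLog d N k L ^ 2 * (d * (N : ℝ) ^ q.α))) := by
  have hN' : (1 : ℝ) ≤ N := by exact_mod_cast hN
  have hd' : (1 : ℝ) ≤ d := by exact_mod_cast hd
  have hk' : (1 : ℝ) ≤ k := by exact_mod_cast hk
  have hl1 : 0 ≤ Real.log N := Real.log_nonneg hN'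
  have hl2 : 0 ≤ Real.log k := Real.log_nonneg hk'
  have hl3 : 0 ≤ Real.log (1 + d) := Real.log_nonneg (by linarith)
  have hl4 : 0 ≤ Real.log (1 + L) := Real.log_nonneg (by linarith)
  have hl5 : 0 ≤ Real.log ((gridSize N L : ℝ) + 1) := Real.log_nonneg (by simp)
  have hl6 : 0 ≤ Real.log ((N : ℝ) + 1) := Real.log_nonneg (by simp)
  have hl7 : 0 ≤ Real.log (2 * (N : ℝ) + 1) := Real.log_nonneg (by linarith)
  set ℓ := knwLog d N k L with hℓ
  have hℓ' : ℓ = 1 + Real.log N + Real.log k + Real.log (1 + d) + Real.log (1 + L) := rfl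
  have hℓ1 : 1 ≤ ℓ := by linarith
  set F := (N : ℝ) ^ q.α * (1 + Real.log N)
  have hF : 0 ≤ F := by positivity
  have hA : d * Real.log (gridSize N L + 1) + 2 * Real.log (N + 1) + 2 + d ≤ 7 * (d * ℓ) := by
    have h3 := log_gridSize_le hN hL
    have h4 := log_add_one_le hN
    have h5 : d * Real.log (gridSize N L + 1) ≤ d * (1 + ℓ) := by gcongr; linarith
    have h6 : ℓ ≤ d * ℓ := le_mul_of_one_le_left (by linarith) hd'
    have h7 : (d : ℝ) ≤ d * ℓ := le_mul_of_one_le_right (by linarith) hℓ1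
    linarith
  have hB : Real.log (2 * N + 1) + Real.log k ≤ 2 * (d * ℓ) := by
    have h3 : Real.log (2 * (N : ℝ) + 1) ≤ 2 + Real.log N := by
      have h3 : Real.log 3 ≤ 2 := by
        have := Real.log_le_sub_one_of_pos (x := 3) (by norm_num); linarith
      calc _ ≤ Real.log (3 * N) := Real.log_le_log (by positivity) (by linarith)
        _ = Real.log 3 + Real.log N := Real.log_mul (by norm_num) (by positivity)
        _ ≤ _ := by linarith
    have h6 : ℓ ≤ d * ℓ := le_mul_of_one_le_left (by linarith) hd'
    linarith
  unfold knwCost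
  rw [lintegral_add_left ((measurable_card_occ N).const_mul _),
    lintegral_const_mul' _ _ ENNReal.ofReal_ne_top, lintegral_const_mul' _ _ ENNReal.ofReal_ne_top,
    lintegral_const_mul' _ _ (ENNReal.natCast_ne_top N)]
  calc _ ≤ ENNReal.ofReal (7 * (d * ℓ)) * ENNReal.ofReal (C * F) +
        ENNReal.ofReal (2 * (d * ℓ)) * ENNReal.ofReal (C * F) :=
        add_le_add (mul_le_mul' (ENNReal.ofReal_le_ofReal hA) h1)
          (mul_le_mul' (ENNReal.ofReal_le_ofReal hB) h2)
    _ = ENNReal.ofReal (9 * C * (d * ℓ * F)) := by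
        rw [← ENNReal.ofReal_mul (by positivity), ← ENNReal.ofReal_mul (by positivity),
          ← ENNReal.ofReal_add (by positivity) (by positivity)]
        congr 1; ring
    _ ≤ _ := by
        refine ENNReal.ofReal_le_ofReal (mul_le_mul_of_nonneg_left ?_ (by positivity))
        have h3 : F ≤ (N : ℝ) ^ q.α * ℓ := by
          refine mul_le_mul_of_nonneg_left ?_ (by positivity); linarith
        calc d * ℓ * F ≤ d * ℓ * ((N : ℝ) ^ q.α * ℓ) := by gcongr
          _ = _ := by ring

/-- The knowledge model has a code whose expected cost is `d N ^ α` up to logarithms. In dimension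
zero all clusters share one law, which costs nothing. -/
theorem exists_hasCode_knowledge (q : PYParams) :
    ∃ C : ℝ, 0 ≤ C ∧ ∀ {d : ℕ} {K : Type*} [Fintype K] [MeasurableSpace K]
      [DiscreteMeasurableSpace K] (knw : Kernel (ParamBall d) K) [IsMarkovKernel knw] {L : ℝ},
      0 < L → (∀ φ₁ φ₂ : ParamBall d, InformationTheory.klDiv (knw φ₁) (knw φ₂) ≤
        ENNReal.ofReal (L * ‖(φ₁ : EuclideanSpace ℝ (Fin d)) - φ₂‖ ^ 2)) →
      ∀ {N : ℕ}, 1 ≤ N → ∃ cost : (ℕ → ℕ) → ℝ≥0∞, Measurable cost ∧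
        ∫⁻ s, cost s ∂(crpLaw q) ≤ ENNReal.ofReal (C *
          (knwLog d N (Fintype.card K) L ^ 2 * (d * (N : ℝ) ^ q.α))) ∧
        HasCode N (Ω := {s : ℕ → ℕ // ∑' k, crpWeight s k = 1} × (ℕ → ParamBall d))
          (fun ω => (pyMixture ((ω.1 : ℕ → ℕ), ω.2)).bind knw) (fun ω => cost ω.1) := by
  obtain ⟨C, hC, h⟩ := exists_crp_bounds q
  refine ⟨9 * C, by positivity, ?_⟩
  intro d K _ _ _ knw _ L hL hKL N hN
  have := nonempty_of_markov knw
  rcases Nat.eq_zero_or_pos d with rfl | hd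
  · refine ⟨fun _ => 0, measurable_const, by simp, Unit, inferInstance, fun _ => 1,
      fun _ => knw ⟨0, by simp⟩, by simp, fun _ => inferInstance, ?_⟩
    rintro ⟨⟨s, hs⟩, θ⟩
    refine ⟨(), ?_⟩
    have h1 : (pyMixture (s, θ)).bind knw = knw ⟨0, by simp⟩ := by
      ext A hA
      rw [pyMixture_bind_apply knw s θ hA]
      have h2 : ∀ k, θ k = ⟨0, by simp⟩ := fun k => Subtype.ext (Subsingleton.elim _ _)
      simp_rw [h2]
      rw [ENNReal.tsum_mul_right, hs, one_mul]
    simp only [h1, InformationTheory.klDiv_self, negLog_one, mul_zero, add_zero, le_refl]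
  · exact ⟨knwCost d N (Fintype.card K) L, measurable_knwCost _ _ _ _,
      lintegral_knwCost_le hC hd hN hL Fintype.card_pos (h N hN).1 (h N hN).2,
      hasCode_knowledge knw hL hKL hN⟩

/-- The syntax vectors are described by one grid cell each. -/
theorem exists_code_syntax {d : ℕ} {Ξ : Type*} [MeasurableSpace Ξ] (ns : ℕ)
    (syn : Kernel (ParamBall d) Ξ) {L : ℝ} (hL : 0 < L)
    (hKL : ∀ φ₁ φ₂ : ParamBall d, InformationTheory.klDiv (syn φ₁) (syn φ₂) ≤
      ENNReal.ofReal (L * ‖(φ₁ : EuclideanSpace ℝ (Fin d)) - φ₂‖ ^ 2))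
    {N : ℕ} (hN : 1 ≤ N) :
    ∃ (ι : Type) (_ : Fintype ι) (w : ℝ≥0∞) (center : ι → Fin ns → ParamBall d),
      ∑ _j : ι, w = 1 ∧
      negLog w = ENNReal.ofReal (ns * (d * Real.log (gridSize N L + 1))) ∧
      ∀ t : Fin ns → ParamBall d, ∃ j, ∀ i,
        InformationTheory.klDiv (syn (t i)) (syn (center j i)) ≤ ENNReal.ofReal (d / N) := by
  classical
  let ι : Type := Fin ns → Fin d → Fin (gridSize N L + 1)
  have hcard : Fintype.card ι = ((gridSize N L + 1) ^ d) ^ ns := by simp [ι]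
  have h0 : ((Fintype.card ι : ℕ) : ℝ≥0∞) ≠ 0 := by exact_mod_cast Fintype.card_ne_zero
  refine ⟨ι, inferInstance, ((Fintype.card ι : ℕ) : ℝ≥0∞)⁻¹, fun c i => gridRep _ (c i), ?_, ?_, ?_⟩
  · rw [Finset.sum_const, Finset.card_univ, nsmul_eq_mul,
      ENNReal.mul_inv_cancel h0 (ENNReal.natCast_ne_top _)]
  · rw [negLog_inv_natCast Fintype.card_pos, hcard]
    push_cast
    rw [Real.log_pow, Real.log_pow]
  · intro t
    refine ⟨fun i => gridCell _ (t i), fun i => (hKL _ _).trans (ENNReal.ofReal_le_ofReal ?_)⟩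
    exact mul_norm_sub_sq_le hN hL (gridCell_gridRep _ _).symm

/-! ### The law of a sentence -/

namespace Model

variable {dk ds ns : ℕ} {K Ξ S : Type*} [MeasurableSpace K] [DiscreteMeasurableSpace K]
  [MeasurableSpace Ξ] [DiscreteMeasurableSpace Ξ] [MeasurableSpace S] [DiscreteMeasurableSpace S]

/-- The law of a sentence whose knowledge element has law `M` and whose syntax vectors are `t`. -/
def pairLaw (m : Model dk ds ns K Ξ S) (M : Measure K) (t : Fin ns → ParamBall ds) : Measure S :=
  M.bind fun κ => (m.syn (t (m.select κ))).map fun ξ => m.encode (ξ, κ)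

theorem lintegral_pairLaw (m : Model dk ds ns K Ξ S) (M : Measure K) (t : Fin ns → ParamBall ds)
    (f : S → ℝ≥0∞) :
    ∫⁻ y, f y ∂(m.pairLaw M t) =
      ∫⁻ κ, ∫⁻ ξ, f (m.encode (ξ, κ)) ∂(m.syn (t (m.select κ))) ∂M := by
  rw [pairLaw, Measure.lintegral_bind Measurable.of_discrete.aemeasurable
    Measurable.of_discrete.aemeasurable]
  refine lintegral_congr fun κ => ?_
  rw [lintegral_map Measurable.of_discrete Measurable.of_discrete]

theorem isProbabilityMeasure_pairLaw (m : Model dk ds ns K Ξ S) (M : Measure K)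
    [IsProbabilityMeasure M] (t : Fin ns → ParamBall ds) :
    IsProbabilityMeasure (m.pairLaw M t) := by
  have h := m.lintegral_pairLaw M t fun _ => 1
  simp only [lintegral_const, measure_univ, mul_one, one_mul] at h
  exact ⟨h⟩

theorem pairLaw_singleton (m : Model dk ds ns K Ξ S) (M : Measure K) (t : Fin ns → ParamBall ds)
    (ξ : Ξ) (κ : K) :
    m.pairLaw M t {m.encode (ξ, κ)} = M {κ} * m.syn (t (m.select κ)) {ξ} := by
  classical
  rw [← lintegral_indicator_one (measurableSet_singleton _), lintegral_pairLaw]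
  have h1 : ∀ κ' ξ', ({m.encode (ξ, κ)} : Set S).indicator (1 : S → ℝ≥0∞) (m.encode (ξ', κ')) =
      ({κ} : Set K).indicator (fun _ => ({ξ} : Set Ξ).indicator (fun _ => (1 : ℝ≥0∞)) ξ') κ' := by
    intro κ' ξ'
    by_cases hκ : κ' = κ <;> by_cases hξ : ξ' = ξ <;>
      simp [Set.indicator, m.encode_injective.eq_iff, hκ, hξ]
  simp_rw [h1]
  have h2 : ∀ κ', ∫⁻ ξ', ({κ} : Set K).indicator
      (fun _ => ({ξ} : Set Ξ).indicator (fun _ => (1 : ℝ≥0∞)) ξ') κ' ∂(m.syn (t (m.select κ'))) =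
      ({κ} : Set K).indicator (fun κ' => m.syn (t (m.select κ')) {ξ}) κ' := by
    intro κ'
    by_cases hκ : κ' = κ
    · simp only [hκ, Set.mem_singleton_iff, Set.indicator_of_mem]
      rw [lintegral_indicator_const (measurableSet_singleton ξ), one_mul]
    · simp [hκ]
  simp_rw [h2]
  rw [lintegral_indicator (measurableSet_singleton κ), lintegral_singleton, mul_comm]

/-- Chain rule: the cross-entropy of a sentence is that of its knowledge element plus the mean
cross-entropy of its syntactic element. -/
theorem lintegral_negLog_pairLaw (m : Model dk ds ns K Ξ S) (M M' : Measure K)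
    [IsProbabilityMeasure M] [IsProbabilityMeasure M'] (t t' : Fin ns → ParamBall ds) :
    ∫⁻ y, negLog (m.pairLaw M' t' {y}) ∂(m.pairLaw M t) =
      ∫⁻ κ, negLog (M' {κ}) ∂M +
        ∫⁻ κ, ∫⁻ ξ, negLog (m.syn (t' (m.select κ)) {ξ}) ∂(m.syn (t (m.select κ))) ∂M := by
  rw [lintegral_pairLaw, ← lintegral_add_left Measurable.of_discrete]
  refine lintegral_congr fun κ => ?_
  simp_rw [pairLaw_singleton, negLog_mul prob_le_one prob_le_one]
  rw [lintegral_add_left measurable_const, lintegral_const, measure_univ, mul_one]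

variable [Fintype K] [Countable Ξ]

/-- The excess of the cross-entropy over the entropy of a sentence. The chain rule is applied to the
entropy as well, so that no entropy has to be finite. -/
theorem lintegral_negLog_pairLaw_le (m : Model dk ds ns K Ξ S) (M M' : Measure K)
    [IsProbabilityMeasure M] [IsProbabilityMeasure M'] (t t' : Fin ns → ParamBall ds) {δ : ℝ≥0∞}
    (h : ∀ i, InformationTheory.klDiv (m.syn (t i)) (m.syn (t' i)) ≤ δ) :
    ∫⁻ y, negLog (m.pairLaw M' t' {y}) ∂(m.pairLaw M t) ≤
      entropy (m.pairLaw M t) + (InformationTheory.klDiv M M' + δ) := by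
  rw [entropy, lintegral_negLog_pairLaw, lintegral_negLog_pairLaw,
    lintegral_negLog_eq_entropy_add_klDiv M M', ← entropy]
  have h1 : ∫⁻ κ, ∫⁻ ξ, negLog (m.syn (t' (m.select κ)) {ξ}) ∂(m.syn (t (m.select κ))) ∂M ≤
      ∫⁻ κ, ∫⁻ ξ, negLog (m.syn (t (m.select κ)) {ξ}) ∂(m.syn (t (m.select κ))) ∂M + δ := by
    calc _ ≤ ∫⁻ κ, (∫⁻ ξ, negLog (m.syn (t (m.select κ)) {ξ}) ∂(m.syn (t (m.select κ))) + δ)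
          ∂M := by
          refine lintegral_mono fun κ => ?_
          rw [lintegral_negLog_eq_entropy_add_klDiv]
          exact add_le_add_right (h _) _
      _ = _ := by rw [lintegral_add_left Measurable.of_discrete]; simp
  refine (add_le_add_right h1 _).trans_eq ?_
  abel

end Model

/-! ### The loss of the mixture of codes -/

theorem measurable_negLog : Measurable negLog := by
  unfold negLog
  have h : Measurable ENNReal.log := ENNReal.log_monotone.measurable
  exact measurable_ereal_toENNReal.comp (h.neg)

namespace Model

variable {dk ds ns : ℕ} {K Ξ S : Type*} [MeasurableSpace K] [MeasurableSpace Ξ] [MeasurableSpace S]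

/-- The joint law of the syntax vectors, the seating sequence and the atoms, from which the data
parameter is a function. -/
def latentLaw (m : Model dk ds ns K Ξ S) (q : PYParams) :
    Measure ((Fin ns → ParamBall ds) × ((ℕ → ℕ) × (ℕ → ParamBall dk))) :=
  (Measure.pi fun _ : Fin ns => m.synBase).prod
    ((crpLaw q).prod (Measure.infinitePi fun _ : ℕ => m.knwBase))

instance isProbabilityMeasure_latentLaw (m : Model dk ds ns K Ξ S) (q : PYParams) :
    IsProbabilityMeasure (m.latentLaw q) := by unfold latentLaw; infer_instance

theorem prior_eq_map (m : Model dk ds ns K Ξ S) (q : PYParams) :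
    m.prior q = (m.latentLaw q).map (Prod.map id pyMixture) := by
  rw [prior, latentLaw, pitmanYor]
  conv_lhs => rw [← Measure.map_id (μ := Measure.pi fun _ : Fin ns => m.synBase)]
  exact Measure.map_prod_map _ _ measurable_id measurable_pyMixture

theorem measurePreserving_seating (m : Model dk ds ns K Ξ S) (q : PYParams) :
    MeasurePreserving (fun ω : (Fin ns → ParamBall ds) × ((ℕ → ℕ) × (ℕ → ParamBall dk)) => ω.2.1)
      (m.latentLaw q) (crpLaw q) :=
  measurePreserving_fst.comp measurePreserving_snd

theorem ae_latent_tsum (m : Model dk ds ns K Ξ S) (q : PYParams) :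
    ∀ᵐ ω ∂(m.latentLaw q), ∑' k, crpWeight ω.2.1 k = 1 :=
  (m.measurePreserving_seating q).quasiMeasurePreserving.ae (ae_tsum_crpWeight q)

theorem ae_prior_isProbabilityMeasure (m : Model dk ds ns K Ξ S) (q : PYParams) :
    ∀ᵐ φ ∂(m.prior q), IsProbabilityMeasure (φ.2.bind m.knw) := by
  have h : ∀ᵐ φ ∂(m.prior q), φ.2 Set.univ = 1 := by
    have hset : MeasurableSet {φ : DataParam dk ds ns | φ.2 Set.univ = 1} :=
      measurableSet_eq_fun ((Measure.measurable_coe MeasurableSet.univ).comp measurable_snd)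
        measurable_const
    rw [prior_eq_map, ae_map_iff (measurable_id.prodMap measurable_pyMixture).aemeasurable hset]
    filter_upwards [m.ae_latent_tsum q] with ω hω
    simpa [pyMixture] using hω
  filter_upwards [h] with φ hφ
  refine ⟨?_⟩
  rw [Measure.bind_apply MeasurableSet.univ m.knw.measurable.aemeasurable]
  simpa using hφ

variable [DiscreteMeasurableSpace K] [DiscreteMeasurableSpace Ξ] [DiscreteMeasurableSpace S]
  [Countable S]

theorem entropy_pi (m : Model dk ds ns K Ξ S) (N : ℕ) (φ : DataParam dk ds ns)
    [IsProbabilityMeasure (φ.2.bind m.knw)] :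
    entropy (m.corpusLaw N φ) = N * entropy (m.sentenceLaw φ) := by
  have : IsProbabilityMeasure (m.sentenceLaw φ) := m.isProbabilityMeasure_pairLaw _ _
  have h := lintegral_negLog_pi (ι := Fin N) (m.sentenceLaw φ) (m.sentenceLaw φ)
  rw [Fintype.card_fin] at h
  exact h

/-- No model beats the conditional entropy. -/
theorem condEntropy_le_bayesLoss (m : Model dk ds ns K Ξ S) (q : PYParams) (N : ℕ)
    (Q : PMF (Fin N → S)) : m.condEntropy q N ≤ m.bayesLoss q N Q := by
  refine lintegral_mono_ae ?_
  filter_upwards [m.ae_prior_isProbabilityMeasure q] with φ hφ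
  have : IsProbabilityMeasure (m.sentenceLaw φ) := m.isProbabilityMeasure_pairLaw _ _
  have : IsProbabilityMeasure (m.corpusLaw N φ) := by unfold corpusLaw; infer_instance
  have h := entropy_le_lintegral_negLog (m.corpusLaw N φ) Q.toMeasure
  simpa only [Q.toMeasure_apply_singleton _ (measurableSet_singleton _)] using h

variable [Fintype K]

theorem measurable_sentenceLaw_singleton (m : Model dk ds ns K Ξ S) (y : S) :
    Measurable fun φ : DataParam dk ds ns => m.sentenceLaw φ {y} := by
  have h : ∀ φ : DataParam dk ds ns, m.sentenceLaw φ {y} =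
      ∑ κ, m.syn (φ.1 (m.select κ)) ((fun ξ => m.encode (ξ, κ)) ⁻¹' {y}) *
        ∫⁻ θ, m.knw θ {κ} ∂φ.2 := by
    intro φ
    rw [sentenceLaw, Measure.bind_apply (measurableSet_singleton y)
      Measurable.of_discrete.aemeasurable, lintegral_fintype]
    refine Finset.sum_congr rfl fun κ _ => ?_
    rw [Measure.map_apply Measurable.of_discrete (measurableSet_singleton y),
      Measure.bind_apply (measurableSet_singleton κ) m.knw.measurable.aemeasurable]
  simp_rw [h]
  refine Finset.measurable_sum _ fun κ _ => Measurable.mul ?_ ?_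
  · exact (m.syn.measurable_coe (MeasurableSet.of_discrete)).comp
      ((measurable_pi_apply _).comp measurable_fst)
  · exact (Measure.measurable_lintegral
      (m.knw.measurable_coe (measurableSet_singleton κ))).comp measurable_snd

/-- Measurability is claimed only almost everywhere because `Measure.pi` is a product measure only
for σ-finite factors, and the sentence law is a probability measure only almost surely. -/
theorem aemeasurable_entropy_corpusLaw (m : Model dk ds ns K Ξ S) (q : PYParams) (N : ℕ) :
    AEMeasurable (fun φ => entropy (m.corpusLaw N φ)) (m.prior q) := by
  refine ⟨fun φ => N * ∑' y, negLog (m.sentenceLaw φ {y}) * m.sentenceLaw φ {y}, ?_, ?_⟩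
  · refine (Measurable.tsum fun y => ?_).const_mul _
    exact (measurable_negLog.comp (m.measurable_sentenceLaw_singleton y)).mul
      (m.measurable_sentenceLaw_singleton y)
  · filter_upwards [m.ae_prior_isProbabilityMeasure q] with φ hφ
    rw [entropy_pi, entropy, lintegral_countable']

variable [Countable Ξ]

/-- The mixture of all product codes, weighted by their prior weights, is a single model whose
loss exceeds the entropy by at most the cost of the codes. -/
theorem exists_pmf_of_hasCode (m : Model dk ds ns K Ξ S) {Ls : ℝ} (hLs : 0 < Ls)
    (hsyn : ∀ φ₁ φ₂ : ParamBall ds, InformationTheory.klDiv (m.syn φ₁) (m.syn φ₂) ≤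
      ENNReal.ofReal (Ls * ‖(φ₁ : EuclideanSpace ℝ (Fin ds)) - φ₂‖ ^ 2))
    {N : ℕ} (hN : 1 ≤ N) {Ω : Type*} {P : Ω → Measure K} {cost : Ω → ℝ≥0∞}
    (hcode : HasCode N P cost) :
    ∃ Q : PMF (Fin N → S), ∀ ω t, IsProbabilityMeasure (P ω) →
      ∫⁻ x, negLog (Q x) ∂(Measure.pi fun _ : Fin N => m.pairLaw (P ω) t) ≤
        N * entropy (m.pairLaw (P ω) t) + (cost ω +
          ENNReal.ofReal (ns * (ds * Real.log (gridSize N Ls + 1)) + ds)) := by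
  obtain ⟨ι, _, w, M', hw, hM', hcode⟩ := hcode
  obtain ⟨ι', _, w', center, hw', hlog, hcenter⟩ := exists_code_syntax ns m.syn hLs hsyn hN
  have hprob : ∀ j : ι × ι', IsProbabilityMeasure (m.pairLaw (M' j.1) (center j.2)) := fun j =>
    have := hM' j.1
    m.isProbabilityMeasure_pairLaw _ _
  let R : ι × ι' → Measure (Fin N → S) := fun j =>
    Measure.pi fun _ : Fin N => m.pairLaw (M' j.1) (center j.2)
  have hR : ∀ j, IsProbabilityMeasure (R j) := fun j => by
    have := hprob j
    simp only [R]; infer_instance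
  let Q : Measure (Fin N → S) := ∑ j, (w j.1 * w') • R j
  have hQ : IsProbabilityMeasure Q := by
    refine ⟨?_⟩
    simp only [Q, Measure.finsetSum_apply, Measure.smul_apply, measure_univ, smul_eq_mul, mul_one]
    rw [Fintype.sum_prod_type]
    simp_rw [← Finset.mul_sum, hw', mul_one, hw]
  -- `Q` dominates the weighted component selected for `(P ω, t)`
  refine ⟨Q.toPMF, fun ω t hP => ?_⟩
  obtain ⟨j, hj⟩ := hcode ω
  obtain ⟨j', hj'⟩ := hcenter t
  have hw1 : w j ≤ 1 := hw ▸ Finset.single_le_sum (fun _ _ => zero_le) (Finset.mem_univ j)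
  have hw1' : w' ≤ 1 :=
    hw' ▸ Finset.single_le_sum (f := fun _ : ι' => w') (fun _ _ => zero_le) (Finset.mem_univ j')
  have := hM' j
  have := hprob (j, j')
  have := m.isProbabilityMeasure_pairLaw (P ω) t
  have h1 := lintegral_negLog_le_of_mul_le (Measure.pi fun _ : Fin N => m.pairLaw (P ω) t)
    (Q := fun x => Q.toPMF x) (Q' := fun x => R (j, j') {x}) (w := w j * w')
    (mul_le_one' hw1 hw1') (fun x => by have := hR (j, j'); exact prob_le_one)
    (fun x => by
      simp only [Measure.toPMF_apply, Q, Measure.finsetSum_apply, Measure.smul_apply, smul_eq_mul]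
      exact Finset.single_le_sum (f := fun j : ι × ι' => w j.1 * w' * R j {x})
        (fun _ _ => zero_le) (Finset.mem_univ (j, j')))
  refine h1.trans ?_
  rw [negLog_mul hw1 hw1', hlog]
  simp only [R]
  rw [lintegral_negLog_pi, Fintype.card_fin]
  refine (add_le_add_right (mul_le_mul_right
    (m.lintegral_negLog_pairLaw_le (P ω) (M' j) t (center j') hj') _) _).trans ?_
  have hN0 : (0 : ℝ) < N := by exact_mod_cast hN
  have h2 : (N : ℝ≥0∞) * ENNReal.ofReal (ds / N) = ENNReal.ofReal ds := by
    rw [← ENNReal.ofReal_natCast N, ← ENNReal.ofReal_mul hN0.le, mul_div_cancel₀ _ hN0.ne']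
  have h3 : 0 ≤ Real.log ((gridSize N Ls : ℝ) + 1) := Real.log_nonneg (by simp)
  rw [mul_add, mul_add, h2, ENNReal.ofReal_add (by positivity) (by positivity)]
  calc _ = N * entropy (m.pairLaw (P ω) t) +
        ((negLog (w j) + N * InformationTheory.klDiv (P ω) (M' j)) +
          (ENNReal.ofReal (ns * (ds * Real.log (gridSize N Ls + 1))) + ENNReal.ofReal ds)) := by
        abel
    _ ≤ _ := add_le_add_right (add_le_add_left hj _) _

/-- The loss of the mixture of codes, averaged over the prior. -/
theorem exists_bayesLoss_le (m : Model dk ds ns K Ξ S) (q : PYParams) {Ls : ℝ} (hLs : 0 < Ls)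
    (hsyn : ∀ φ₁ φ₂ : ParamBall ds, InformationTheory.klDiv (m.syn φ₁) (m.syn φ₂) ≤
      ENNReal.ofReal (Ls * ‖(φ₁ : EuclideanSpace ℝ (Fin ds)) - φ₂‖ ^ 2))
    {N : ℕ} (hN : 1 ≤ N) {cost : (ℕ → ℕ) → ℝ≥0∞} (hcost : Measurable cost)
    (hcode : HasCode N (Ω := {s : ℕ → ℕ // ∑' k, crpWeight s k = 1} × (ℕ → ParamBall dk))
      (fun ω => (pyMixture ((ω.1 : ℕ → ℕ), ω.2)).bind m.knw) (fun ω => cost ω.1)) :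
    ∃ Q : PMF (Fin N → S), m.bayesLoss q N Q ≤ m.condEntropy q N + (∫⁻ s, cost s ∂(crpLaw q) +
      ENNReal.ofReal (ns * (ds * Real.log (gridSize N Ls + 1)) + ds)) := by
  obtain ⟨Q, hQ⟩ := m.exists_pmf_of_hasCode hLs hsyn hN hcode
  refine ⟨Q, ?_⟩
  have hg : Measurable (Prod.map id pyMixture :
      (Fin ns → ParamBall ds) × ((ℕ → ℕ) × (ℕ → ParamBall dk)) → DataParam dk ds ns) :=
    measurable_id.prodMap measurable_pyMixture
  have hent := m.aemeasurable_entropy_corpusLaw q N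
  rw [prior_eq_map] at hent
  rw [bayesLoss, condEntropy, prior_eq_map, lintegral_map' hent hg.aemeasurable]
  refine (lintegral_map_le _ _).trans ?_
  calc _ ≤ ∫⁻ ω, (entropy (m.corpusLaw N (Prod.map id pyMixture ω)) + (cost ω.2.1 +
          ENNReal.ofReal (ns * (ds * Real.log (gridSize N Ls + 1)) + ds))) ∂(m.latentLaw q) := by
        refine lintegral_mono_ae ?_
        filter_upwards [m.ae_latent_tsum q] with ω hω
        obtain ⟨t, s, θ⟩ := ω
        have hprob : IsProbabilityMeasure ((pyMixture (s, θ)).bind m.knw) :=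
          isProbabilityMeasure_pyMixture_bind m.knw θ hω
        have : IsProbabilityMeasure
            (Measure.bind (Prod.map id pyMixture (t, s, θ) : DataParam dk ds ns).2 m.knw) := hprob
        rw [entropy_pi]
        exact hQ (⟨s, hω⟩, θ) t hprob
    _ = _ := by
        have hent' : AEMeasurable (fun ω => entropy (m.corpusLaw N (Prod.map id pyMixture ω)))
          (m.latentLaw q) := hent.comp_aemeasurable hg.aemeasurable
        rw [lintegral_add_left' hent',
          lintegral_add_right _ measurable_const, lintegral_const, measure_univ, mul_one,
          ← (m.measurePreserving_seating q).lintegral_comp hcost]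

end Model

theorem syntaxCost_le {N ns ds : ℕ} {L : ℝ} (hN : 1 ≤ N) (hns : 1 ≤ ns) (hL : 0 < L) :
    ns * (ds * Real.log (gridSize N L + 1)) + ds ≤
      3 * ((1 + Real.log N + Real.log (1 + ds) + Real.log (1 + L)) ^ 2 * (ns * ds)) := by
  have hN' : (1 : ℝ) ≤ N := by exact_mod_cast hN
  have hns' : (1 : ℝ) ≤ ns := by exact_mod_cast hns
  have hds : (0 : ℝ) ≤ ds := ds.cast_nonneg
  have hl1 : 0 ≤ Real.log N := Real.log_nonneg hN'
  have hl3 : 0 ≤ Real.log (1 + ds) := Real.log_nonneg (by linarith)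
  have hl4 : 0 ≤ Real.log (1 + L) := Real.log_nonneg (by linarith)
  have h1 := log_gridSize_le hN hL
  set ℓ := 1 + Real.log N + Real.log (1 + ds) + Real.log (1 + L) with hℓ
  have hℓ1 : 1 ≤ ℓ := by linarith
  have hℓ2 : ℓ ≤ ℓ ^ 2 := by nlinarith
  calc ns * (ds * Real.log (gridSize N L + 1)) + ds
      ≤ ns * (ds * (2 + Real.log N + Real.log (1 + L))) + ns * ds := by
        gcongr
        exact le_mul_of_one_le_left hds hns'
    _ = (ns * ds) * (3 + Real.log N + Real.log (1 + L)) := by ring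
    _ ≤ (ns * ds) * (3 * ℓ ^ 2) := by gcongr; linarith
    _ = _ := by ring

end SyntaxKnowledge

end

theorem mainTheorem2 (q : SyntaxKnowledge.PYParams) :
    ∃ (C : ℝ) (r : ℕ),
      ∀ (dk ds ns : ℕ) (K Ξ S : Type*)
        [Fintype K] [MeasurableSpace K] [DiscreteMeasurableSpace K]
        [Countable Ξ] [MeasurableSpace Ξ] [DiscreteMeasurableSpace Ξ]
        [Countable S] [MeasurableSpace S] [DiscreteMeasurableSpace S]
        (m : SyntaxKnowledge.Model dk ds ns K Ξ S) (Lk Ls : ℝ),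
        0 < Lk → 0 < Ls → m.KLLipschitz Lk Ls →
        ∀ N : ℕ, 1 ≤ N →
          ∃ R : ℝ≥0∞,
            (⨅ Q : PMF (Fin N → S), m.bayesLoss q N Q / (N : ℝ≥0∞)) =
              R + m.condEntropy q N / (N : ℝ≥0∞) ∧
            R ≤ ENNReal.ofReal (C *
              ((1 + Real.log N + Real.log (Fintype.card K) + Real.log (1 + dk)
                  + Real.log (1 + Lk)) ^ r * (dk / (N : ℝ) ^ (1 - q.α)) +
               (1 + Real.log N + Real.log (1 + ds) + Real.log (1 + Ls)) ^ r *
                  (ns * ds / N))) := by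
  obtain ⟨C, hC, hknw⟩ := SyntaxKnowledge.exists_hasCode_knowledge q
  refine ⟨C + 3, 2, ?_⟩
  intro dk ds ns K Ξ S _ _ _ _ _ _ _ _ _ m Lk Ls hLk hLs hLip N hN
  -- `K` carries a probability measure and is mapped to `Fin ns`, so `ns` is positive
  have hK := SyntaxKnowledge.nonempty_of_markov m.knw
  have hns : 1 ≤ ns := (Nat.zero_le _).trans_lt (m.select hK.some).2
  have hN0 : (0 : ℝ) < N := by exact_mod_cast hN
  obtain ⟨cost, hmeas, hcost, hcode⟩ := hknw m.knw hLk hLip.1 hN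
  obtain ⟨Q, hQ⟩ := m.exists_bayesLoss_le q hLs hLip.2 hN hmeas hcode
  refine ⟨(⨅ Q : PMF (Fin N → S), m.bayesLoss q N Q / (N : ℝ≥0∞)) -
    m.condEntropy q N / (N : ℝ≥0∞), (tsub_add_cancel_of_le ?_).symm, ?_⟩
  · exact le_iInf fun Q => ENNReal.div_le_div_right (m.condEntropy_le_bayesLoss q N Q) _
  rw [tsub_le_iff_left]
  refine (iInf_le _ Q).trans ((ENNReal.div_le_div_right hQ _).trans ?_)
  rw [ENNReal.add_div]
  refine add_le_add_right ?_ _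
  have hpow : (N : ℝ) ^ (1 - q.α) = N / (N : ℝ) ^ q.α := by
    rw [Real.rpow_sub hN0, Real.rpow_one]
  rw [hpow]
  have hsyn := SyntaxKnowledge.syntaxCost_le (ds := ds) hN hns hLs
  unfold SyntaxKnowledge.knwLog at hcost
  set a := (1 + Real.log N + Real.log (Fintype.card K) + Real.log (1 + dk)
    + Real.log (1 + Lk)) ^ 2 with ha
  set b := (1 + Real.log N + Real.log (1 + ds) + Real.log (1 + Ls)) ^ 2 with hb
  have ha0 : 0 ≤ a := sq_nonneg _
  have hb0 : 0 ≤ b := sq_nonneg _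
  rw [ENNReal.div_le_iff (by exact_mod_cast hN0.ne') (ENNReal.natCast_ne_top N),
    ← ENNReal.ofReal_natCast N, ← ENNReal.ofReal_mul (by positivity)]
  refine (add_le_add hcost (ENNReal.ofReal_le_ofReal hsyn)).trans ?_
  rw [← ENNReal.ofReal_add (by positivity) (by positivity)]
  refine ENNReal.ofReal_le_ofReal ?_
  have hNα : 0 < (N : ℝ) ^ q.α := Real.rpow_pos_of_pos hN0 _
  have h1 : (C + 3) * (a * (dk / (N / (N : ℝ) ^ q.α)) + b * (ns * ds / N)) * N =
      (C + 3) * (a * (dk * (N : ℝ) ^ q.α)) + (C + 3) * (b * (ns * ds)) := by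
    field_simp
  rw [h1]
  gcongr <;> linarith
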